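/- A \emph{hexagonal system} $(\mathbb J,\mathbb F,\#)$ consists of a commutative field $\mathbb F$, an $\mathbb F$-vector space $\mathbb J$, a map $\#:\mathbb J\to\mathbb J$, a function $\mathsf N:\mathbb J\to\mathbb F$, a symmetric bilinear form $\mathsf T:\mathbb J\times\mathbb J\to\mathbb F$, a symmetric bilinear map $\times:\mathbb J\times\mathbb J\to\mathbb J$ and an element $1\in\mathbb J\setminus\{0\}$ such that for all $t\in\mathbb F$, $a,b,c\in\mathbb J$: $(ta)^\#=t^2a^\#$; $\mathsf N(ta)=t^3\mathsf N(a)$; $\mathsf T(a,b\times c)=\mathsf T(a\times b,c)$; $(a+b)^\#=a^\#+a\times b+b^\#$; $\mathsf N(a+b)=\mathsf N(a)+\mathsf T(a^\#,b)+\mathsf T(a,b^\#)+\mathsf N(b)$; $\mathsf T(a,a^\#)=3\mathsf N(a)$; $a^{\#\#}=\mathsf N(a)a$; $a^\#\times(a\times b)=\mathsf N(a)b+\mathsf T(a^\#,b)a$; $a^\#\times b^\#+(a\times b)^\#=\mathsf T(a^\#,b)b+\mathsf T(a,b^\#)a$; $1^\#=1$; $a=\mathsf T(a,1)1-1\times a$;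 and $\mathsf N(a)=0$ only if $a=0$. Write $\mathsf T(a)=\mathsf T(a,1)$, $a^{-1}=\mathsf N(a)^{-1}a^\#$ for $a\ne0$, and identify $t\in\mathbb F$ with $t1\in\mathbb J$. An automorphism of the system is an $\mathbb F$-linear bijection $h$ of $\mathbb J$, written $a\mapsto a^h$, with $(a^\#)^h=(a^h)^\#$ for all $a$. Let $\Gamma$ be the Moufang hexagon of $(\mathbb J,\mathbb F,\#)$, that is, the one with positive root groups $U_i=\{x_i(c)\}$, $1\le i\le 6$ ($c\in\mathbb J$ for $i$ odd, $c\in\mathbb F$ for $i$ even, each $x_i$ additive), whose nontrivial commutator relations are, with $[g,k]=g^{-1}k^{-1}gk$, $[x_1(a),x_3(b)]=x_2(\mathsf T(a,b))$, $[x_3(a),x_5(b)]=x_4(\mathsf T(a,b))$, $[x_1(a),x_5(b)]=x_2(-\mathsf T(a^\#,b))x_3(a\times b)x_4(\mathsf T(a,b^\#))$, $[x_2(t),x_6(u)]=x_4(tu)$, $[x_1(a),x_6(t)]=x_2(-t\mathsf N(a))x_3(ta^\#)x_4(t^2\mathsf N(a))x_5(-ta)$, where the points on a line are indexed by $\{\infty\}\cup\mathbb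 F$ and the lines through a point by $\{\infty\}\cup\mathbb J$. Explicitly, the points of $\Gamma$ are $(\infty)$, $(t)$, $(b,u)$, $(t,a,t')$, $(b,u,b',u')$, $(t,a,t',a',t'')$ and the lines are $[\infty]$, $[b]$, $[t,a]$, $[b,u,b']$, $[t,a,t',a']$, $[b,u,b',u',b'']$ with $t,t',t'',u,u'\in\mathbb F$ and $a,a',b,b',b''\in\mathbb J$; consecutive terms of $$(t,a,t',a',t''),[t,a,t',a'],(t,a,t'),[t,a],(t),[\infty],(\infty),[b],(b,u),[b,u,b'],(b,u,b',u'),[b,u,b',u',b'']$$ are incident, $(t,a,t',a',t'')$ is incident with $[b,u,b',u',b'']$ if and only if $a=b''-tb$, $t'=u'+t^2\mathsf N(b)+ut-t\mathsf T(b'',b^\#)+\mathsf T(b',b'')+\mathsf T(b''^\#,b)$, $a'=b'+b\times b''-tb^\#$ and $t''=u-t\mathsf N(b)+\mathsf T(b,b')+\mathsf T(b'',b^\#)$, and there are no other incidences. Here $(t,a,t',a',t'')$ stands for the coset of $x_6(t)x_5(a)x_4(t')x_3(a')x_2(t'')$, and $[b,u,b',u',b'']$ for that of $x_1(b)x_2(u)x_3(b')x_4(u')x_5(b'')$,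 and similarly for shorter tuples; $x_1(c)$ acts by left multiplication. Let $x_7(a)$ denote the elements of the root group opposite to $U_1$ with respect to the base apartment (the one formed by the elements with all coordinates $0$ or $\infty$), indexed so that $s_1=x_7(1)x_1(1)x_7(1)$ stabilises this apartment and $s_1x_1(a)s_1^{-1}=x_7(a)$. An automorphism $h$ of the hexagonal system is regarded as the collineation of $\Gamma$ that applies $h$ to every $\mathbb J$-coordinate. \textbf{Theorem.} Let $h:\mathbb J\to\mathbb J$ be an automorphism of the hexagonal system $(\mathbb J,\mathbb F,\#)$, of order $1$ or $3$, such that $$\mathsf T(a)=a+a^h+a^{h^2}\quad\text{and}\quad \mathsf T(a^\#)=\mathsf T(a,a^h)\qquad\text{for all }a\in\mathbb J.$$ Then the collineation $\theta=h\,x_1(1)\,s_1$ of $\Gamma$ (a product of maps acting from the left) is point-domestic: no point $p$ of $\Gamma$ is opposite $\theta(p)$, where two points are opposite if they are at distance $6$ in the incidence graph. -/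

import Mathlib

/-- A hexagonal system `(J, F, #)`: a vector space `J` over a commutative field `F` with an
adjoint `#`, together with the norm, the trace form, the symmetric bilinear product `×` and the
identity that belong to it. -/
structure HexagonalSystem (F J : Type*) [Field F] [AddCommGroup J] [Module F J] where
  /-- the adjoint `a ↦ a^#` -/
  sharp : J → J
  /-- the norm `N` -/
  norm : J → F
  /-- the trace form `T(a, b)` -/
  tr : J →ₗ[F] J →ₗ[F] F
  /-- the product `a × b` -/
  cross : J →ₗ[F] J →ₗ[F] J
  /-- the identity `1` -/
  one : J
  one_ne_zero : one ≠ 0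
  tr_comm : ∀ a b, tr a b = tr b a
  cross_comm : ∀ a b, cross a b = cross b a
  sharp_smul : ∀ (t : F) (a : J), sharp (t • a) = t ^ 2 • sharp a
  norm_smul : ∀ (t : F) (a : J), norm (t • a) = t ^ 3 * norm a
  tr_cross : ∀ a b c, tr a (cross b c) = tr (cross a b) c
  sharp_add : ∀ a b, sharp (a + b) = sharp a + cross a b + sharp b
  norm_add : ∀ a b, norm (a + b) = norm a + tr (sharp a) b + tr a (sharp b) + norm b
  tr_sharp : ∀ a, tr a (sharp a) = 3 * norm a
  sharp_sharp : ∀ a, sharp (sharp a) = norm a • a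
  sharp_cross_cross : ∀ a b,
    cross (sharp a) (cross a b) = norm a • b + tr (sharp a) b • a
  sharp_cross_sharp : ∀ a b,
    cross (sharp a) (sharp b) + sharp (cross a b) = tr (sharp a) b • b + tr a (sharp b) • a
  sharp_one : sharp one = one
  eq_tr_sub : ∀ a, a = tr a one • one - cross one a
  norm_eq_zero_iff : ∀ a, norm a = 0 ↔ a = 0

/-- The points of the hexagon, in coordinates: the point `(∞)` and the tuples
`(t)`, `(b, u)`, `(t, a, t')`, `(b, u, b', u')`, `(t, a, t', a', t'')`.  They stand for the cosets
`P₁`, `x₆(t)s₆P₁`, `x₁(b)x₂(u)s₁s₆P₁`, `x₆(t)x₅(a)x₄(t')s₆s₁s₆P₁`,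
`x₁(b)x₂(u)x₃(b')x₄(u')s₁s₆s₁s₆P₁`, `x₆(t)x₅(a)x₄(t')x₃(a')x₂(t'')s₆s₁s₆s₁s₆P₁`. -/
inductive HexPoint (F J : Type*) where
  | p0 : HexPoint F J
  | p1 (t : F) : HexPoint F J
  | p2 (b : J) (u : F) : HexPoint F J
  | p3 (t : F) (a : J) (t' : F) : HexPoint F J
  | p4 (b : J) (u : F) (b' : J) (u' : F) : HexPoint F J
  | p5 (t : F) (a : J) (t' : F) (a' : J) (t'' : F) : HexPoint F J

/-- The lines of the hexagon, in coordinates: the line `[∞]` and the tuples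
`[b]`, `[t, a]`, `[b, u, b']`, `[t, a, t', a']`, `[b, u, b', u', b'']`.  They stand for the cosets
`P₆`, `x₁(b)s₁P₆`, `x₆(t)x₅(a)s₆s₁P₆`, `x₁(b)x₂(u)x₃(b')s₁s₆s₁P₆`,
`x₆(t)x₅(a)x₄(t')x₃(a')s₆s₁s₆s₁P₆`, `x₁(b)x₂(u)x₃(b')x₄(u')x₅(b'')s₁s₆s₁s₆s₁P₆`. -/
inductive HexLine (F J : Type*) where
  | l0 : HexLine F J
  | l1 (b : J) : HexLine F J
  | l2 (t : F) (a : J) : HexLine F J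
  | l3 (b : J) (u : F) (b' : J) : HexLine F J
  | l4 (t : F) (a : J) (t' : F) (a' : J) : HexLine F J
  | l5 (b : J) (u : F) (b' : J) (u' : F) (b'' : J) : HexLine F J

namespace HexagonalSystem

open HexPoint HexLine

noncomputable section

variable {F J : Type*} [Field F] [AddCommGroup J] [Module F J] (S : HexagonalSystem F J)

/-- The trace `T(a) = T(a, 1)`. -/
def trace (a : J) : F := S.tr a S.one

/-- The inverse `a⁻¹ = N(a)⁻¹ a^#`. -/
def inv (a : J) : J := (S.norm a)⁻¹ • S.sharp a

/-- An automorphism of the hexagonal system: a vector space automorphism commuting with `#`. -/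
def IsAut (h : J ≃ₗ[F] J) : Prop := ∀ a, h (S.sharp a) = S.sharp (h a)

/-- Incidence in the Moufang hexagon of the hexagonal system. -/
def Inc : HexPoint F J → HexLine F J → Prop
  | p0, l0 => True
  | p0, l1 _ => True
  | p1 _, l0 => True
  | p1 t, l2 t₁ _ => t = t₁
  | p2 b _, l1 b₁ => b = b₁
  | p2 b u, l3 b₁ u₁ _ => b = b₁ ∧ u = u₁
  | p3 t a _, l2 t₁ a₁ => t = t₁ ∧ a = a₁
  | p3 t a t', l4 t₁ a₁ t₁' _ => t = t₁ ∧ a = a₁ ∧ t' = t₁'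
  | p4 b u b' _, l3 b₁ u₁ b₁' => b = b₁ ∧ u = u₁ ∧ b' = b₁'
  | p4 b u b' u', l5 b₁ u₁ b₁' u₁' _ => b = b₁ ∧ u = u₁ ∧ b' = b₁' ∧ u' = u₁'
  | p5 t a t' a' _, l4 t₁ a₁ t₁' a₁' => t = t₁ ∧ a = a₁ ∧ t' = t₁' ∧ a' = a₁'
  | p5 t a t' a' t'', l5 b u b' u' b'' =>
      a = b'' - t • b ∧
      t' = u' + t ^ 2 * S.norm b + u * t - t * S.tr b'' (S.sharp b) + S.tr b' b''
        + S.tr (S.sharp b'') b ∧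
      a' = b' + S.cross b b'' - t • S.sharp b ∧
      t'' = u - t * S.norm b + S.tr b b' + S.tr b'' (S.sharp b)
  | _, _ => False

/-- The incidence graph of the hexagon. -/
def incGraph : SimpleGraph (HexPoint F J ⊕ HexLine F J) :=
  SimpleGraph.fromRel fun x y => ∃ p l, x = Sum.inl p ∧ y = Sum.inr l ∧ S.Inc p l

/-- Two elements of the hexagon are opposite if they are at distance `6` in the incidence graph. -/
def Opposite (x y : HexPoint F J ⊕ HexLine F J) : Prop := S.incGraph.dist x y = 6

/-- The group `G` of all collineations of the hexagon: pairs of a permutation of the points and a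
permutation of the lines that preserve incidence and non-incidence. -/
def collineationGroup :
    Subgroup (Equiv.Perm (HexPoint F J) × Equiv.Perm (HexLine F J)) where
  carrier := {g | ∀ p l, S.Inc (g.1 p) (g.2 l) ↔ S.Inc p l}
  mul_mem' := by
    intro g k hg hk p l
    exact (hg _ _).trans (hk _ _)
  one_mem' := fun p l => Iff.rfl
  inv_mem' := by
    intro g hg p l
    have := hg (g.1⁻¹ p) (g.2⁻¹ l)
    simpa using this.symm

/-- A collineation is point-domestic if it maps no point to an opposite point. -/
def PointDomestic (g : S.collineationGroup) : Prop :=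
  ∀ p : HexPoint F J, ¬ S.Opposite (Sum.inl p) (Sum.inl (g.1.1 p))

/-! ### Elementary identities -/

lemma sharp_zero : S.sharp 0 = 0 := by
  have := S.sharp_smul 0 0
  simpa using this

lemma norm_zero : S.norm 0 = 0 := (S.norm_eq_zero_iff 0).2 rfl

lemma sharp_neg (a : J) : S.sharp (-a) = S.sharp a := by
  have := S.sharp_smul (-1) a
  simpa using this

lemma norm_neg (a : J) : S.norm (-a) = - S.norm a := by
  have := S.norm_smul (-1) a
  have h3 : ((-1 : F)) ^ 3 = -1 := by ring
  simpa [h3] using this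

lemma cross_self (a : J) : S.cross a a = (2 : F) • S.sharp a := by
  have h1 := S.sharp_add a a
  have h2 := S.sharp_smul 2 a
  rw [two_smul] at h2
  rw [h2] at h1
  have : S.cross a a = ((2 : F) ^ 2 • S.sharp a) - S.sharp a - S.sharp a := by
    rw [h1]; abel
  rw [this]; module

lemma norm_ne_zero {a : J} (ha : a ≠ 0) : S.norm a ≠ 0 := fun h =>
  ha ((S.norm_eq_zero_iff a).1 h)

lemma sharp_ne_zero {a : J} (ha : a ≠ 0) : S.sharp a ≠ 0 := by
  intro h
  have h1 := S.sharp_sharp a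
  rw [h, S.sharp_zero] at h1
  exact (smul_ne_zero (S.norm_ne_zero ha) ha) h1.symm

lemma norm_sharp {a : J} : S.norm (S.sharp a) = S.norm a ^ 2 := by
  by_cases ha : a = 0
  · subst ha; simp [S.sharp_zero, S.norm_zero]
  · have h1 := S.sharp_sharp (S.sharp a)
    rw [S.sharp_sharp a, S.sharp_smul] at h1
    exact (smul_left_injective F (S.sharp_ne_zero ha) h1).symm

lemma cross_cross_sharp (a b : J) :
    S.cross a (S.cross (S.sharp a) b) = S.norm a • b + S.tr a b • S.sharp a := by
  by_cases ha : a = 0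
  · subst ha; simp [S.norm_zero]
  · have h1 := S.sharp_cross_cross (S.sharp a) b
    rw [S.sharp_sharp, S.norm_sharp] at h1
    simp only [map_smul, LinearMap.smul_apply] at h1
    have h2 : S.norm a • S.cross a (S.cross (S.sharp a) b)
        = S.norm a • (S.norm a • b + S.tr a b • S.sharp a) := by
      rw [h1]; simp only [smul_eq_mul]; module
    exact smul_right_injective J (S.norm_ne_zero ha) h2

lemma isAut_norm {h : J ≃ₗ[F] J} (hh : S.IsAut h) (a : J) : S.norm (h a) = S.norm a := by
  by_cases ha : a = 0
  · subst ha; simp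
  · have h1 := S.sharp_sharp (h a)
    rw [← hh, ← hh, S.sharp_sharp, map_smul] at h1
    exact (smul_left_injective F (by simpa using ha : h a ≠ 0) h1).symm

lemma isAut_cross {h : J ≃ₗ[F] J} (hh : S.IsAut h) (a b : J) :
    S.cross (h a) (h b) = h (S.cross a b) := by
  have h1 := S.sharp_add (h a) (h b)
  rw [← map_add, ← hh, S.sharp_add, ← hh, ← hh, map_add, map_add] at h1
  exact (add_left_cancel (add_right_cancel h1)).symm

lemma isAut_tr {h : J ≃ₗ[F] J} (hh : S.IsAut h) (a b : J) :
    S.tr (h a) (h b) = S.tr a b := by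
  by_cases ha : a = 0
  · subst ha; simp
  · have key : ∀ c : J, c ≠ 0 → S.tr (h (S.sharp c)) (h b) = S.tr (S.sharp c) b := by
      intro c hc
      have h1 := S.sharp_cross_cross (h c) (h b)
      rw [← hh, S.isAut_cross hh, S.isAut_cross hh, S.sharp_cross_cross, S.isAut_norm hh,
        map_add, map_smul, map_smul] at h1
      exact (smul_left_injective F (by simpa using hc : h c ≠ 0) (add_left_cancel h1)).symm
    have h2 := key (S.sharp a) (S.sharp_ne_zero ha)
    rw [S.sharp_sharp] at h2
    simp only [map_smul, LinearMap.smul_apply, smul_eq_mul] at h2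
    exact mul_left_cancel₀ (S.norm_ne_zero ha) h2

/-! ### The collineation induced by an automorphism of the hexagonal system -/

/-- Apply `h` to the `J`-coordinates of a point. -/
def autPoint (h : J ≃ₗ[F] J) : HexPoint F J → HexPoint F J
  | p0 => p0
  | p1 t => p1 t
  | p2 b u => p2 (h b) u
  | p3 t a t' => p3 t (h a) t'
  | p4 b u b' u' => p4 (h b) u (h b') u'
  | p5 t a t' a' t'' => p5 t (h a) t' (h a') t''

/-- Apply `h` to the `J`-coordinates of a line. -/
def autLine (h : J ≃ₗ[F] J) : HexLine F J → HexLine F J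
  | l0 => l0
  | l1 b => l1 (h b)
  | l2 t a => l2 t (h a)
  | l3 b u b' => l3 (h b) u (h b')
  | l4 t a t' a' => l4 t (h a) t' (h a')
  | l5 b u b' u' b'' => l5 (h b) u (h b') u' (h b'')

/-- An automorphism `h` of the hexagonal system, regarded as a collineation: it acts
coordinatewise, that is, `h xᵢ(c) h⁻¹ = xᵢ(c^h)` and `h` fixes the base apartment. -/
def ofAut (h : J ≃ₗ[F] J) (hh : S.IsAut h) : S.collineationGroup :=
  ⟨(⟨autPoint h, autPoint h.symm, by rintro (_ | _) <;> simp [autPoint],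
      by rintro (_ | _) <;> simp [autPoint]⟩,
    ⟨autLine h, autLine h.symm, by rintro (_ | _) <;> simp [autLine],
      by rintro (_ | _) <;> simp [autLine]⟩), by
    intro p l
    have e1 : ∀ (x y z : J) (t : F), h x = h y - t • h z ↔ x = y - t • z := fun x y z t => by
      rw [← map_smul, ← map_sub, h.injective.eq_iff]
    have e2 : ∀ (x y z w : J) (t : F), h x = h y + h z - t • h w ↔ x = y + z - t • w :=
      fun x y z w t => by
        rw [← map_smul, ← map_add, ← map_sub, h.injective.eq_iff]
    cases p <;> cases l <;>
      simp [autPoint, autLine, Inc, ← hh _, S.isAut_norm hh, S.isAut_tr hh, S.isAut_cross hh,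
        e1, e2]⟩

/-! ### The root elations `x₁(c)` -/

/-- The action of `x₁(c)` on points, by left multiplication on the cosets. -/
def x₁Point (c : J) : HexPoint F J → HexPoint F J
  | p0 => p0
  | p1 t => p1 t
  | p2 b u => p2 (b + c) u
  | p3 t a t' => p3 t (a - t • c)
      (t' + t ^ 2 * S.norm c - t * S.tr (S.sharp c) a + S.tr c (S.sharp a))
  | p4 b u b' u' => p4 (b + c) u b' u'
  | p5 t a t' a' t'' => p5 t (a - t • c)
      (t' + t ^ 2 * S.norm c - t * S.tr (S.sharp c) a + S.tr c (S.sharp a))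
      (a' + S.cross c a - t • S.sharp c)
      (t'' - t * S.norm c + S.tr (S.sharp c) a + S.tr c a')

/-- The action of `x₁(c)` on lines, by left multiplication on the cosets. -/
def x₁Line (c : J) : HexLine F J → HexLine F J
  | l0 => l0
  | l1 b => l1 (b + c)
  | l2 t a => l2 t (a - t • c)
  | l3 b u b' => l3 (b + c) u b'
  | l4 t a t' a' => l4 t (a - t • c)
      (t' + t ^ 2 * S.norm c - t * S.tr (S.sharp c) a + S.tr c (S.sharp a))
      (a' + S.cross c a - t • S.sharp c)
  | l5 b u b' u' b'' => l5 (b + c) u b' u' b''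

lemma tr_sharp' (a : J) : S.tr (S.sharp a) a = 3 * S.norm a := by
  rw [S.tr_comm, S.tr_sharp]

lemma sharp_sub (a b : J) : S.sharp (a - b) = S.sharp a - S.cross a b + S.sharp b := by
  rw [sub_eq_add_neg, S.sharp_add, S.sharp_neg, map_neg, ← sub_eq_add_neg]

lemma tr_cross_self (a b : J) : S.tr a (S.cross a b) = 2 * S.tr (S.sharp a) b := by
  rw [S.tr_cross, S.cross_self]; simp

lemma tr_cross_self' (a b : J) : S.tr a (S.cross b a) = 2 * S.tr (S.sharp a) b := by
  rw [S.cross_comm, S.tr_cross_self]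

lemma x₁Point_neg (c : J) (p : HexPoint F J) : S.x₁Point (-c) (S.x₁Point c p) = p := by
  cases p <;>
    simp only [x₁Point, S.norm_neg, S.sharp_neg, add_neg_cancel_right, smul_neg, sub_neg_eq_add,
      sub_add_cancel, S.sharp_sub, S.sharp_smul, map_smul, map_neg, map_sub, map_add,
      LinearMap.neg_apply, smul_eq_mul, S.tr_sharp', S.tr_sharp, S.tr_cross_self,
      S.tr_cross_self', S.cross_self, HexPoint.p3.injEq, HexPoint.p5.injEq, true_and]
  · ring
  · refine ⟨by ring, by module, by ring⟩

lemma x₁Line_neg (c : J) (l : HexLine F J) : S.x₁Line (-c) (S.x₁Line c l) = l := by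
  cases l <;>
    simp only [x₁Line, S.norm_neg, S.sharp_neg, add_neg_cancel_right, smul_neg, sub_neg_eq_add,
      sub_add_cancel, S.sharp_sub, S.sharp_smul, map_smul, map_neg, map_sub, map_add,
      LinearMap.neg_apply, smul_eq_mul, S.tr_sharp', S.tr_sharp, S.tr_cross_self,
      S.tr_cross_self', S.cross_self, HexLine.l4.injEq, true_and]
  · refine ⟨by ring, by module⟩

lemma x₁_inc (c : J) {p : HexPoint F J} {l : HexLine F J} (h : S.Inc p l) :
    S.Inc (S.x₁Point c p) (S.x₁Line c l) := by
  cases p <;> cases l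
  case p5.l5 t a t' a' t'' b u b' u' b'' =>
    obtain ⟨rfl, rfl, rfl, rfl⟩ := h
    have e1 : S.tr b (S.cross c b'') = S.tr b'' (S.cross b c) := by
      rw [S.tr_cross, S.tr_comm]
    have e2 : S.tr c (S.cross b b'') = S.tr b'' (S.cross b c) := by
      rw [S.tr_cross, S.tr_comm, S.cross_comm]
    have e3 : S.tr c (S.cross b'' b) = S.tr b'' (S.cross b c) := by
      rw [S.cross_comm, e2]
    have e4 := S.tr_comm c b'
    have e5 := S.tr_comm (S.sharp c) b''
    have e6 := S.tr_comm (S.sharp c) b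
    have e7 := S.tr_comm c (S.sharp b)
    have e8 := S.tr_comm c (S.sharp b'')
    have e9 := S.cross_comm c b
    have e10 := S.tr_comm b c
    have e11 := S.tr_comm b b'
    simp only [Inc, x₁Point, x₁Line, S.norm_add, S.sharp_add, S.sharp_sub, S.sharp_smul, map_smul,
      map_sub, map_add, LinearMap.add_apply, smul_eq_mul, e1, e2, e3, e4, e5, e6, e7, e8, e9, e11]
    refine ⟨by module, by ring, by module, by ring⟩
  all_goals
    simp only [Inc, x₁Point, x₁Line] at h ⊢
    try grind

/-- The root elation `x₁(c)`. -/
def x₁ (c : J) : S.collineationGroup :=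
  ⟨(⟨S.x₁Point c, S.x₁Point (-c), S.x₁Point_neg c, fun p => by
        simpa using S.x₁Point_neg (-c) p⟩,
    ⟨S.x₁Line c, S.x₁Line (-c), S.x₁Line_neg c, fun l => by
        simpa using S.x₁Line_neg (-c) l⟩), fun p l =>
    ⟨fun h => by
      have := S.x₁_inc (-c) (p := S.x₁Point c p) (l := S.x₁Line c l) h
      rwa [S.x₁Point_neg, S.x₁Line_neg] at this, S.x₁_inc c⟩⟩

/-! ### The group `U₊` and the commutator relations

The hexagon of `(J, F, #)` is by definition the one whose positive root groups `U₁, …, U₆` satisfy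
the commutator relations below.  They present the group `U₊` with the normal form
`x₆(t) x₅(a) x₄(t') x₃(a') x₂(t'') x₁(c)`, and the point `(t, a, t', a', t'')` is incident with the
line `[b, u, b', u', b'']` exactly when the corresponding cosets of `U₁` and `U₆` intersect. -/

/-- The element `x₆(t) x₅(a) x₄(t') x₃(a') x₂(t'') x₁(c)` of `U₊`. -/
@[ext]
structure UPlus {F J : Type*} [Field F] [AddCommGroup J] [Module F J]
    (S : HexagonalSystem F J) where
  t : F
  a : J
  t' : F
  a' : J
  t'' : F
  c : J

namespace UPlus

variable {S}

instance : Mul (UPlus S) where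
  mul g k :=
    { t := g.t + k.t
      a := g.a + (k.a - k.t • g.c)
      t' := g.t' + (k.t' + k.t ^ 2 * S.norm g.c - k.t * S.tr (S.sharp g.c) k.a
        + S.tr g.c (S.sharp k.a)) + g.t'' * k.t + S.tr g.a' (k.a - k.t • g.c)
      a' := g.a' + (k.a' + S.cross g.c k.a - k.t • S.sharp g.c)
      t'' := g.t'' + (k.t'' - k.t * S.norm g.c + S.tr (S.sharp g.c) k.a + S.tr g.c k.a')
      c := g.c + k.c }

instance : One (UPlus S) where
  one := ⟨0, 0, 0, 0, 0, 0⟩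

instance : Inv (UPlus S) where
  inv g :=
    { t := -g.t
      a := -g.a - g.t • g.c
      t' := -g.t' + g.t * g.t'' + S.tr g.a' g.a - g.t ^ 2 * S.norm g.c
        - g.t * S.tr (S.sharp g.c) g.a - S.tr g.c (S.sharp g.a)
      a' := -g.a' + S.cross g.c g.a + g.t • S.sharp g.c
      t'' := -g.t'' - g.t * S.norm g.c - S.tr (S.sharp g.c) g.a + S.tr g.c g.a'
      c := -g.c }

lemma mul_def (g k : UPlus S) : g * k =
    { t := g.t + k.t
      a := g.a + (k.a - k.t • g.c)
      t' := g.t' + (k.t' + k.t ^ 2 * S.norm g.c - k.t * S.tr (S.sharp g.c) k.a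
        + S.tr g.c (S.sharp k.a)) + g.t'' * k.t + S.tr g.a' (k.a - k.t • g.c)
      a' := g.a' + (k.a' + S.cross g.c k.a - k.t • S.sharp g.c)
      t'' := g.t'' + (k.t'' - k.t * S.norm g.c + S.tr (S.sharp g.c) k.a + S.tr g.c k.a')
      c := g.c + k.c } := rfl

instance : Group (UPlus S) :=
  Group.ofLeftAxioms
    (by
      rintro ⟨t, a, t', a', t'', c⟩ ⟨s, d, s', d', s'', e⟩ ⟨r, f, r', f', r'', k⟩
      have q1 : S.tr c (S.cross d f) = S.tr (S.cross c d) f := S.tr_cross c d f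
      have q2 : S.tr c (S.cross e f) = S.tr (S.cross c e) f := S.tr_cross c e f
      have q3 : S.tr c (S.cross d e) = S.tr (S.cross c d) e := S.tr_cross c d e
      have q4 : S.tr (S.cross c e) d = S.tr (S.cross c d) e := by
        rw [← S.tr_cross, S.cross_comm e d, S.tr_cross]
      have q5 : S.tr (S.cross c f) e = S.tr (S.cross c e) f := by
        rw [← S.tr_cross, S.cross_comm f e, S.tr_cross]
      have q6 : S.tr (S.cross c e) e = 2 * S.tr c (S.sharp e) := by
        rw [← S.tr_cross, S.cross_self]; simp
      have q7 : S.tr (S.cross c e) c = 2 * S.tr (S.sharp c) e := by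
        rw [S.tr_comm, S.tr_cross_self]
      have q8 : S.tr (S.cross c d) c = 2 * S.tr (S.sharp c) d := by
        rw [S.tr_comm, S.tr_cross_self]
      have q9 : S.tr (S.cross c f) c = 2 * S.tr (S.sharp c) f := by
        rw [S.tr_comm, S.tr_cross_self]
      have q10 := S.tr_comm (S.sharp e) c
      have q11 := S.tr_comm d' c
      ext <;> simp only [mul_def, S.sharp_sub, S.sharp_add, S.sharp_smul, S.norm_add, map_sub,
        map_add, map_smul, LinearMap.sub_apply, LinearMap.add_apply, LinearMap.smul_apply,
        smul_eq_mul, S.cross_self, S.tr_sharp, S.tr_sharp', q1, q2, q3, q4, q5, q6, q7, q8, q9,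
        q10, q11, S.cross_comm f c, S.cross_comm f e, S.cross_comm d c, S.cross_comm e c]
      · ring
      · module
      · ring
      · module
      · ring
      · module)
    (by
      rintro ⟨t, a, t', a', t'', c⟩
      change (⟨0, 0, 0, 0, 0, 0⟩ : UPlus S) * _ = _
      ext <;> simp [mul_def, S.sharp_zero, S.norm_zero])
    (by
      rintro ⟨t, a, t', a', t'', c⟩
      change (⟨_, _, _, _, _, _⟩ : UPlus S) * _ = ⟨0, 0, 0, 0, 0, 0⟩
      have q1 : S.tr (S.cross c a) a = 2 * S.tr c (S.sharp a) := by
        rw [← S.tr_cross, S.cross_self]; simp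
      have q2 : S.tr (S.cross c a) c = 2 * S.tr (S.sharp c) a := by
        rw [S.tr_comm, S.tr_cross_self]
      ext <;> simp only [mul_def, S.sharp_neg, S.norm_neg, map_sub, map_add, map_smul, map_neg,
        LinearMap.sub_apply, LinearMap.add_apply, LinearMap.smul_apply, LinearMap.neg_apply,
        smul_eq_mul, S.tr_sharp', q1, q2, S.tr_comm a' c, smul_neg]
      · ring
      · module
      · ring
      · module
      · ring
      · module)

variable (S)

/-- `x₁(c)` in `U₊` -/
def y₁ (c : J) : UPlus S := ⟨0, 0, 0, 0, 0, c⟩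
/-- `x₂(t)` in `U₊` -/
def y₂ (t : F) : UPlus S := ⟨0, 0, 0, 0, t, 0⟩
/-- `x₃(a)` in `U₊` -/
def y₃ (a : J) : UPlus S := ⟨0, 0, 0, a, 0, 0⟩
/-- `x₄(t)` in `U₊` -/
def y₄ (t : F) : UPlus S := ⟨0, 0, t, 0, 0, 0⟩
/-- `x₅(a)` in `U₊` -/
def y₅ (a : J) : UPlus S := ⟨0, a, 0, 0, 0, 0⟩
/-- `x₆(t)` in `U₊` -/
def y₆ (t : F) : UPlus S := ⟨t, 0, 0, 0, 0, 0⟩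

lemma normal_form (t : F) (a : J) (t' : F) (a' : J) (t'' : F) (c : J) :
    y₆ S t * y₅ S a * y₄ S t' * y₃ S a' * y₂ S t'' * y₁ S c = ⟨t, a, t', a', t'', c⟩ := by
  ext <;> simp [mul_def, y₁, y₂, y₃, y₄, y₅, y₆, S.sharp_zero, S.norm_zero]

lemma comm_of_mul_eq {G : Type*} [Group G] {g k m : G} (h : g * k = k * g * m) :
    g⁻¹ * k⁻¹ * g * k = m := by
  rw [mul_assoc, h]; group

/-- The nontrivial commutator relations, where `[g, k] = g⁻¹ k⁻¹ g k`. -/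
lemma comm_rel (a b : J) (t u : F) :
    (y₁ S a)⁻¹ * (y₃ S b)⁻¹ * y₁ S a * y₃ S b = y₂ S (S.tr a b) ∧
    (y₃ S a)⁻¹ * (y₅ S b)⁻¹ * y₃ S a * y₅ S b = y₄ S (S.tr a b) ∧
    (y₁ S a)⁻¹ * (y₅ S b)⁻¹ * y₁ S a * y₅ S b =
      y₂ S (-S.tr (S.sharp a) b) * y₃ S (S.cross a b) * y₄ S (S.tr a (S.sharp b)) ∧
    (y₂ S t)⁻¹ * (y₆ S u)⁻¹ * y₂ S t * y₆ S u = y₄ S (t * u) ∧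
    (y₁ S a)⁻¹ * (y₆ S t)⁻¹ * y₁ S a * y₆ S t =
      y₂ S (-(t * S.norm a)) * y₃ S (t • S.sharp a) * y₄ S (t ^ 2 * S.norm a)
        * y₅ S (-(t • a)) := by
  refine ⟨comm_of_mul_eq ?_, comm_of_mul_eq ?_, comm_of_mul_eq ?_, comm_of_mul_eq ?_,
    comm_of_mul_eq ?_⟩ <;> ext <;>
    simp [mul_def, y₁, y₂, y₃, y₄, y₅, y₆, S.sharp_zero, S.norm_zero, S.sharp_neg,
      S.sharp_smul, S.tr_cross_self, S.tr_sharp, S.tr_sharp', S.cross_self] <;>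
    first | ring1 | module

lemma inc_iff_cosets_meet (t : F) (a : J) (t' : F) (a' : J) (t'' : F)
    (b : J) (u : F) (b' : J) (u' : F) (b'' : J) :
    S.Inc (p5 t a t' a' t'') (l5 b u b' u' b'') ↔
      ∃ (c : J) (s : F),
        y₆ S t * y₅ S a * y₄ S t' * y₃ S a' * y₂ S t'' * y₁ S c =
          y₁ S b * y₂ S u * y₃ S b' * y₄ S u' * y₅ S b'' * y₆ S s := by
  have q : S.tr (S.cross b b'') b = 2 * S.tr b'' (S.sharp b) := by
    rw [S.tr_comm, S.tr_cross_self, S.tr_comm]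
  have key : ∀ s : F, y₁ S b * y₂ S u * y₃ S b' * y₄ S u' * y₅ S b'' * y₆ S s =
      ⟨s, b'' - s • b,
        u' + s ^ 2 * S.norm b + u * s - s * S.tr b'' (S.sharp b) + S.tr b' b''
          + S.tr (S.sharp b'') b,
        b' + S.cross b b'' - s • S.sharp b,
        u - s * S.norm b + S.tr b b' + S.tr b'' (S.sharp b), b⟩ := by
    intro s
    ext <;> simp [mul_def, y₁, y₂, y₃, y₄, y₅, y₆, S.sharp_zero, S.tr_comm (S.sharp b) b'',
      S.tr_comm b (S.sharp b''), q, S.tr_comm b' b]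
    all_goals first | ring1 | module
  simp only [normal_form, key, UPlus.mk.injEq, Inc]
  constructor
  · rintro ⟨h1, h2, h3, h4⟩
    exact ⟨b, t, rfl, h1, h2, h3, h4, rfl⟩
  · rintro ⟨c, s, rfl, h1, h2, h3, h4, _⟩
    exact ⟨h1, h2, h3, h4⟩

/-- `x₁(c)` acts on the points `(t, a, t', a', t'')` by left multiplication. -/
lemma x₁Point_eq_mul (c : J) (g : UPlus S) :
    S.x₁Point c (p5 g.t g.a g.t' g.a' g.t'') =
      p5 (y₁ S c * g).t (y₁ S c * g).a (y₁ S c * g).t' (y₁ S c * g).a' (y₁ S c * g).t'' := by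
  simp [mul_def, y₁, x₁Point]

end UPlus

/-! ### The reflection `w` of the base apartment -/

open Classical in
/-- The action on points of the collineation `w` that fixes `(∞)`, interchanges `[∞]` and `[0]`,
stabilises the base apartment, and for which
`w x₁(c) w⁻¹ = x₇(c)`, `w x₂(t) w⁻¹ = x₆(t)`, `w x₃(c) w⁻¹ = x₅(c)`, `w x₄(t) w⁻¹ = x₄(t)`,
`w x₅(c) w⁻¹ = x₃(-c)`, `w x₆(t) w⁻¹ = x₂(-t)`. -/
def wPoint : HexPoint F J → HexPoint F J
  | p0 => p0
  | p1 t => p2 0 (-t)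
  | p2 b u => if b = 0 then p1 u else p2 (-S.inv b) (-((S.norm b)⁻¹ * u))
  | p3 t a t' => p4 0 (-t) (-a) t'
  | p4 b u b' u' => if b = 0 then p3 u b' u' else
      p4 (-S.inv b) (-((S.norm b)⁻¹ * u))
        (S.cross (S.inv b) b' - ((S.norm b)⁻¹ * (u + S.tr b b')) • b)
        (u' - (S.norm b)⁻¹ * u * (u + S.tr b b') - S.tr (S.inv b) (S.sharp b'))
  | p5 t a t' a' t'' => p5 t'' a' (t' - t * t'' - S.tr a a') (-a) (-t)

open Classical in
/-- The action of `w` on lines. -/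
def wLine : HexLine F J → HexLine F J
  | l0 => l1 0
  | l1 b => if b = 0 then l0 else l1 (-S.inv b)
  | l2 t a => l3 0 (-t) (-a)
  | l3 b u b' => if b = 0 then l2 u b' else
      l3 (-S.inv b) (-((S.norm b)⁻¹ * u))
        (S.cross (S.inv b) b' - ((S.norm b)⁻¹ * (u + S.tr b b')) • b)
  | l4 t a t' a' => l5 0 (-t) (-a) t' a'
  | l5 b u b' u' b'' => if b = 0 then l4 u b' u' (-b'') else
      l5 (-S.inv b) (-((S.norm b)⁻¹ * u))
        (S.cross (S.inv b) b' - ((S.norm b)⁻¹ * (u + S.tr b b')) • b)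
        (u' - (S.norm b)⁻¹ * u * (u + S.tr b b') - S.tr (S.inv b) (S.sharp b'))
        (b' + S.cross b b'' - (u + S.tr b b' + S.tr b'' (S.sharp b)) • S.inv b)

lemma inv_ne_zero {b : J} (hb : b ≠ 0) : S.inv b ≠ 0 :=
  smul_ne_zero (_root_.inv_ne_zero (S.norm_ne_zero hb)) (S.sharp_ne_zero hb)

lemma norm_inv {b : J} : S.norm (S.inv b) = (S.norm b)⁻¹ := by
  by_cases hb : b = 0
  · subst hb; simp [inv, S.norm_zero]
  · have := S.norm_ne_zero hb
    rw [inv, S.norm_smul, S.norm_sharp]; field_simp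

lemma sharp_inv {b : J} (hb : b ≠ 0) : S.sharp (S.inv b) = (S.norm b)⁻¹ • b := by
  have := S.norm_ne_zero hb
  rw [inv, S.sharp_smul, S.sharp_sharp, smul_smul]; congr 1; field_simp

lemma inv_neg (b : J) : S.inv (-b) = -S.inv b := by
  rw [inv, inv, S.norm_neg, S.sharp_neg, _root_.inv_neg, neg_smul]

lemma inv_inv {b : J} (hb : b ≠ 0) : S.inv (S.inv b) = b := by
  have := S.norm_ne_zero hb
  rw [inv, S.norm_inv, S.sharp_inv hb, smul_smul]; simp [this]

lemma tr_inv_self {b : J} (hb : b ≠ 0) : S.tr (S.inv b) b = 3 := by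
  have := S.norm_ne_zero hb
  rw [inv]; simp only [map_smul, LinearMap.smul_apply, S.tr_sharp', smul_eq_mul]; field_simp

lemma sharp_eq {b : J} (hb : b ≠ 0) : S.sharp b = S.norm b • S.inv b := by
  have := S.norm_ne_zero hb
  rw [inv, smul_smul]; simp [this]

lemma inv_cross_cross {b : J} (hb : b ≠ 0) (c : J) :
    S.cross (S.inv b) (S.cross b c) = c + S.tr (S.inv b) c • b := by
  have := S.norm_ne_zero hb
  rw [inv]; simp only [map_smul, LinearMap.smul_apply, S.sharp_cross_cross, smul_add, smul_smul]
  simp [this]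

lemma cross_inv_cross {b : J} (hb : b ≠ 0) (c : J) :
    S.cross b (S.cross (S.inv b) c) = c + S.tr b c • S.inv b := by
  have := S.inv_cross_cross (S.inv_ne_zero hb) c
  rwa [S.inv_inv hb] at this

lemma tr_inv_cross_inv {b : J} (hb : b ≠ 0) (c : J) :
    S.tr (S.inv b) (S.cross (S.inv b) c) = 2 * ((S.norm b)⁻¹ * S.tr b c) := by
  rw [S.tr_cross_self, S.sharp_inv hb]; simp

lemma tr_sharp_cross (b c : J) :
    S.tr (S.sharp b) (S.sharp (S.cross b c))
      = S.tr (S.sharp b) c ^ 2 + S.norm b * S.tr b (S.sharp c) := by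
  have h1 : S.sharp (S.cross b c)
      = S.tr (S.sharp b) c • c + S.tr b (S.sharp c) • b - S.cross (S.sharp b) (S.sharp c) := by
    rw [← S.sharp_cross_sharp]; abel
  rw [h1]
  simp only [map_add, map_sub, map_smul, smul_eq_mul, S.tr_cross_self, S.sharp_sharp,
    LinearMap.smul_apply, S.tr_sharp']
  ring

lemma tr_inv_sharp_cross {b : J} (hb : b ≠ 0) (c : J) :
    S.tr (S.inv b) (S.sharp (S.cross b c))
      = S.norm b * S.tr (S.inv b) c ^ 2 + S.tr b (S.sharp c) := by
  have hn := S.norm_ne_zero hb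
  have h := S.tr_sharp_cross b c
  rw [S.sharp_eq hb] at h
  simp only [map_smul, LinearMap.smul_apply, smul_eq_mul] at h
  apply mul_left_cancel₀ hn
  rw [h]; ring

lemma tr_sharp_inv_cross {b : J} (hb : b ≠ 0) (c : J) :
    S.tr b (S.sharp (S.cross (S.inv b) c))
      = (S.norm b)⁻¹ * S.tr b c ^ 2 + S.tr (S.inv b) (S.sharp c) := by
  have := S.tr_inv_sharp_cross (S.inv_ne_zero hb) c
  rwa [S.inv_inv hb, S.norm_inv] at this

/-- The square of `w` on points. -/
def w2Point : HexPoint F J → HexPoint F J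
  | p0 => p0
  | p1 t => p1 (-t)
  | p2 b u => p2 b (-u)
  | p3 t a t' => p3 (-t) (-a) t'
  | p4 b u b' u' => p4 b (-u) (-b') u'
  | p5 t a t' a' t'' => p5 (-t) (-a) t' (-a') (-t'')

/-- The square of `w` on lines. -/
def w2Line : HexLine F J → HexLine F J
  | l0 => l0
  | l1 b => l1 b
  | l2 t a => l2 (-t) (-a)
  | l3 b u b' => l3 b (-u) (-b')
  | l4 t a t' a' => l4 (-t) (-a) t' (-a')
  | l5 b u b' u' b'' => l5 b (-u) (-b') u' (-b'')

lemma w_aux2 {b : J} (hb : b ≠ 0) (u : F) :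
    -((S.norm (-S.inv b))⁻¹ * -((S.norm b)⁻¹ * u)) = -u := by
  have := S.norm_ne_zero hb
  rw [S.norm_neg, S.norm_inv]; field_simp

lemma w_aux_tr {b : J} (hb : b ≠ 0) (u : F) (b' : J) :
    S.tr (S.inv b) (S.cross (S.inv b) b' - ((S.norm b)⁻¹ * (u + S.tr b b')) • b)
      = -((S.norm b)⁻¹ * (3 * u + S.tr b b')) := by
  simp only [map_sub, map_smul, S.tr_inv_cross_inv hb, S.tr_inv_self hb, smul_eq_mul]
  ring

lemma w_aux3 {b : J} (hb : b ≠ 0) (u : F) (b' : J) :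
    S.cross (S.inv (-S.inv b)) (S.cross (S.inv b) b' - ((S.norm b)⁻¹ * (u + S.tr b b')) • b)
      - ((S.norm (-S.inv b))⁻¹ * (-((S.norm b)⁻¹ * u) + S.tr (-S.inv b)
        (S.cross (S.inv b) b' - ((S.norm b)⁻¹ * (u + S.tr b b')) • b))) • (-S.inv b) = -b' := by
  have hn := S.norm_ne_zero hb
  rw [map_neg S.tr, LinearMap.neg_apply, S.w_aux_tr hb, S.norm_neg, S.norm_inv, S.inv_neg,
    S.inv_inv hb]
  simp only [map_sub, map_neg, map_smul, LinearMap.neg_apply, S.cross_inv_cross hb, S.cross_self,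
    S.sharp_eq hb, smul_smul]
  match_scalars <;> field_simp <;> ring

lemma w_aux4 {b : J} (hb : b ≠ 0) (u : F) (b' : J) (u' : F) :
    (u' - (S.norm b)⁻¹ * u * (u + S.tr b b') - S.tr (S.inv b) (S.sharp b'))
      - (S.norm (-S.inv b))⁻¹ * (-((S.norm b)⁻¹ * u)) * (-((S.norm b)⁻¹ * u) + S.tr (-S.inv b)
        (S.cross (S.inv b) b' - ((S.norm b)⁻¹ * (u + S.tr b b')) • b))
      - S.tr (S.inv (-S.inv b)) (S.sharp
        (S.cross (S.inv b) b' - ((S.norm b)⁻¹ * (u + S.tr b b')) • b)) = u' := by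
  have hn := S.norm_ne_zero hb
  rw [map_neg S.tr (S.inv b), LinearMap.neg_apply, S.w_aux_tr hb, S.norm_neg, S.norm_inv, S.inv_neg,
    S.inv_inv hb]
  have e : S.tr b (S.cross (S.cross (S.inv b) b') b) = 4 * S.tr b b' := by
    rw [S.cross_comm, S.cross_inv_cross hb]
    simp only [map_add, map_smul, smul_eq_mul, S.tr_comm b (S.inv b), S.tr_inv_self hb]
    ring
  simp only [S.sharp_sub, S.sharp_smul, map_sub, map_add, map_neg, map_smul, LinearMap.neg_apply,
    S.tr_sharp_inv_cross hb, S.tr_sharp, e, smul_eq_mul]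
  field_simp
  ring

lemma w_aux5 {b : J} (hb : b ≠ 0) (u : F) (b' b'' : J) :
    (S.cross (S.inv b) b' - ((S.norm b)⁻¹ * (u + S.tr b b')) • b)
      + S.cross (-S.inv b)
        (b' + S.cross b b'' - (u + S.tr b b' + S.tr b'' (S.sharp b)) • S.inv b)
      - (-((S.norm b)⁻¹ * u) + S.tr (-S.inv b)
          (S.cross (S.inv b) b' - ((S.norm b)⁻¹ * (u + S.tr b b')) • b)
        + S.tr (b' + S.cross b b'' - (u + S.tr b b' + S.tr b'' (S.sharp b)) • S.inv b)
            (S.sharp (-S.inv b))) • S.inv (-S.inv b) = -b'' := by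
  have hn := S.norm_ne_zero hb
  rw [map_neg S.tr (S.inv b), LinearMap.neg_apply, S.w_aux_tr hb, S.inv_neg, S.sharp_neg,
    S.inv_inv hb, S.sharp_inv hb]
  have e : S.tr (S.cross b b'') b = 2 * S.norm b * S.tr b'' (S.inv b) := by
    rw [S.tr_comm, S.tr_cross_self, S.sharp_eq hb, S.tr_comm b'']; simp; ring
  simp only [map_sub, map_add, map_neg, map_smul, LinearMap.neg_apply, LinearMap.add_apply,
    LinearMap.sub_apply, LinearMap.smul_apply, S.inv_cross_cross hb, S.cross_self, e,
    S.sharp_inv hb, S.tr_inv_self hb, S.sharp_eq hb, smul_eq_mul, S.tr_comm b' b,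
    S.tr_comm b'' (S.inv b)]
  match_scalars <;> field_simp <;> ring

lemma wPoint_wPoint (p : HexPoint F J) : S.wPoint (S.wPoint p) = w2Point p := by
  cases p
  case p0 => rfl
  case p1 t => simp [wPoint, w2Point]
  case p3 t a t' => simp [wPoint, w2Point]
  case p5 t a t' a' t'' => simp [wPoint, w2Point, S.tr_comm a' a]; ring
  case p2 b u =>
    by_cases hb : b = 0
    · subst hb; simp [wPoint, w2Point]
    · have h1 := S.inv_ne_zero hb
      simp only [wPoint, w2Point, hb, if_false, neg_eq_zero, h1, S.w_aux2 hb]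
      rw [S.inv_neg, S.inv_inv hb, neg_neg]
  case p4 b u b' u' =>
    by_cases hb : b = 0
    · subst hb; simp [wPoint, w2Point]
    · have h1 := S.inv_ne_zero hb
      simp only [wPoint, w2Point, hb, if_false, neg_eq_zero, h1, S.w_aux2 hb, S.w_aux3 hb,
        S.w_aux4 hb]
      rw [S.inv_neg, S.inv_inv hb, neg_neg]

lemma wLine_wLine (l : HexLine F J) : S.wLine (S.wLine l) = w2Line l := by
  cases l
  case l0 => simp [wLine, w2Line]
  case l2 t a => simp [wLine, w2Line]
  case l4 t a t' a' => simp [wLine, w2Line]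
  case l1 b =>
    by_cases hb : b = 0
    · subst hb; simp [wLine, w2Line]
    · have h1 := S.inv_ne_zero hb
      simp only [wLine, w2Line, hb, if_false, neg_eq_zero, h1]
      rw [S.inv_neg, S.inv_inv hb, neg_neg]
  case l3 b u b' =>
    by_cases hb : b = 0
    · subst hb; simp [wLine, w2Line]
    · have h1 := S.inv_ne_zero hb
      simp only [wLine, w2Line, hb, if_false, neg_eq_zero, h1, S.w_aux2 hb, S.w_aux3 hb]
      rw [S.inv_neg, S.inv_inv hb, neg_neg]
  case l5 b u b' u' b'' =>
    by_cases hb : b = 0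
    · subst hb; simp [wLine, w2Line]
    · have h1 := S.inv_ne_zero hb
      simp only [wLine, w2Line, hb, if_false, neg_eq_zero, h1, S.w_aux2 hb, S.w_aux3 hb,
        S.w_aux4 hb, S.w_aux5 hb]
      rw [S.inv_neg, S.inv_inv hb, neg_neg]

lemma w_inc55 {b : J} (hb : b ≠ 0) (t u : F) (b' : J) (u' : F) (b'' : J)
    {a : J} {t' : F} {a' : J} {t'' : F}
    (h : S.Inc (p5 t a t' a' t'') (l5 b u b' u' b'')) :
    S.Inc (S.wPoint (p5 t a t' a' t'')) (S.wLine (l5 b u b' u' b'')) := by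
  obtain ⟨rfl, rfl, rfl, rfl⟩ := h
  have hn := S.norm_ne_zero hb
  have e1 : S.tr (S.cross b b'') b = 2 * S.norm b * S.tr (S.inv b) b'' := by
    rw [S.tr_comm, S.tr_cross_self, S.sharp_eq hb]; simp; ring
  have e2 : S.tr (S.cross (S.inv b) b') b' = 2 * S.tr (S.inv b) (S.sharp b') := by
    rw [← S.tr_cross, S.cross_self]; simp
  have e3 : S.tr (S.cross (S.inv b) b') (S.cross b b'')
      = S.tr b' b'' + S.tr (S.inv b) b'' * S.tr b b' := by
    rw [S.cross_comm, ← S.tr_cross, S.inv_cross_cross hb, S.tr_comm b b']; simp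
  have e4 : S.tr (S.cross (S.inv b) b') (S.inv b) = 2 * ((S.norm b)⁻¹ * S.tr b b') := by
    rw [S.tr_comm, S.tr_inv_cross_inv hb]
  have e5 : S.tr b (S.cross b b'') = 2 * S.norm b * S.tr (S.inv b) b'' := by
    rw [S.tr_comm, e1]
  have e6 : S.tr (S.cross b' (S.cross b b'')) (S.inv b)
      = S.tr b' b'' + S.tr (S.inv b) b'' * S.tr b b' := by
    rw [← S.tr_cross, S.cross_comm _ (S.inv b), S.inv_cross_cross hb, S.tr_comm b b']; simp
  have e7 : S.tr (S.sharp (S.cross b b'')) (S.inv b)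
      = S.norm b * S.tr (S.inv b) b'' ^ 2 + S.tr b (S.sharp b'') := by
    rw [S.tr_comm, S.tr_inv_sharp_cross hb]
  have e8 : S.tr (S.cross b' (S.inv b)) (S.inv b) = 2 * ((S.norm b)⁻¹ * S.tr b b') := by
    rw [S.cross_comm, e4]
  have e9 : S.tr (S.cross (S.cross b b'') (S.inv b)) (S.inv b) = 4 * S.tr (S.inv b) b'' := by
    rw [← S.tr_cross, S.cross_self, S.sharp_inv hb]
    simp only [map_smul, e1, smul_eq_mul]; field_simp; ring
  have e10 : S.tr b'' (S.cross b b'') = 2 * S.tr b (S.sharp b'') := by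
    rw [S.tr_cross_self', S.tr_comm]
  have e11 : S.tr b (S.inv b) = 3 := by rw [S.tr_comm, S.tr_inv_self hb]
  simp only [wPoint, wLine, hb, if_false, Inc]
  refine ⟨?_, ?_, ?_, ?_⟩
  · simp only [S.sharp_eq hb, map_smul, smul_eq_mul]
    module
  · rw [S.sharp_neg, S.sharp_inv hb, S.norm_neg, S.norm_inv]
    simp only [S.sharp_eq hb, S.sharp_sub, S.sharp_add, S.sharp_smul, S.sharp_inv hb, map_smul,
      map_add, map_sub, map_neg, LinearMap.add_apply, LinearMap.sub_apply, LinearMap.smul_apply,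
      LinearMap.neg_apply, smul_eq_mul, e1, e2, e3, e4, e5, e6, e7, e8, e9, e10, e11,
      S.tr_comm b'' (S.inv b), S.tr_comm b' b, S.tr_comm b'' b', S.tr_comm b' (S.inv b),
      S.tr_comm (S.sharp b'') b, S.tr_comm (S.sharp b') (S.inv b), S.tr_inv_self hb]
    field_simp
    ring
  · rw [S.sharp_neg, S.sharp_inv hb]
    simp only [S.sharp_eq hb, map_smul, map_add, map_sub, map_neg, LinearMap.neg_apply,
      smul_eq_mul, S.inv_cross_cross hb, S.cross_self, S.sharp_inv hb, S.tr_comm b'' (S.inv b)]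
    match_scalars <;> field_simp <;> ring
  · rw [map_neg S.tr (S.inv b), LinearMap.neg_apply, S.w_aux_tr hb, S.sharp_neg, S.sharp_inv hb,
      S.norm_neg, S.norm_inv]
    simp only [S.sharp_eq hb, map_smul, map_add, map_sub, LinearMap.add_apply,
      LinearMap.sub_apply, LinearMap.smul_apply, smul_eq_mul, e1, S.tr_inv_self hb,
      S.tr_comm b' b, S.tr_comm b'' (S.inv b)]
    field_simp
    ring

lemma w_inc {p : HexPoint F J} {l : HexLine F J} (h : S.Inc p l) :
    S.Inc (S.wPoint p) (S.wLine l) := by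
  cases p <;> cases l
  case p5.l5 t a t' a' t'' b u b' u' b'' =>
    by_cases hb : b = 0
    · subst hb
      obtain ⟨rfl, rfl, rfl, rfl⟩ := h
      simp [wPoint, wLine, Inc, S.norm_zero, S.sharp_zero, S.tr_comm b'' b']
      ring
    · exact S.w_inc55 hb t u b' u' b'' h
  case p2.l1 b u b₁ =>
    obtain rfl := h
    by_cases hb : b = 0 <;> simp [wPoint, wLine, Inc, hb]
  case p2.l3 b u b₁ u₁ b₁' =>
    obtain ⟨rfl, rfl⟩ := h
    by_cases hb : b = 0 <;> simp [wPoint, wLine, Inc, hb]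
  case p4.l3 b u b' u' b₁ u₁ b₁' =>
    obtain ⟨rfl, rfl, rfl⟩ := h
    by_cases hb : b = 0 <;> simp [wPoint, wLine, Inc, hb]
  case p4.l5 b u b' u' b₁ u₁ b₁' u₁' b'' =>
    obtain ⟨rfl, rfl, rfl, rfl⟩ := h
    by_cases hb : b = 0 <;> simp [wPoint, wLine, Inc, hb]
  case p0.l1 b =>
    by_cases hb : b = 0 <;> simp [wPoint, wLine, Inc, hb]
  case p5.l4 t a t' a' t'' t₁ a₁ t₁' a₁' =>
    obtain ⟨rfl, rfl, rfl, rfl⟩ := h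
    simp [wPoint, wLine, Inc, S.norm_zero, S.sharp_zero, S.tr_comm a' a]
    ring
  all_goals simp_all [wPoint, wLine, Inc]

lemma wPoint_pow_four (p : HexPoint F J) :
    S.wPoint (S.wPoint (S.wPoint (S.wPoint p))) = p := by
  rw [S.wPoint_wPoint, S.wPoint_wPoint]
  cases p <;> simp [w2Point]

lemma wLine_pow_four (l : HexLine F J) : S.wLine (S.wLine (S.wLine (S.wLine l))) = l := by
  rw [S.wLine_wLine, S.wLine_wLine]
  cases l <;> simp [w2Line]

/-- The collineation `w`, a reflection of the base apartment. -/
def w : S.collineationGroup :=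
  ⟨(⟨S.wPoint, fun p => S.wPoint (S.wPoint (S.wPoint p)), S.wPoint_pow_four, S.wPoint_pow_four⟩,
    ⟨S.wLine, fun l => S.wLine (S.wLine (S.wLine l)), S.wLine_pow_four, S.wLine_pow_four⟩),
    fun p l => ⟨fun h => by
      have := S.w_inc (S.w_inc (S.w_inc (p := S.wPoint p) (l := S.wLine l) h))
      rwa [S.wPoint_pow_four, S.wLine_pow_four] at this, S.w_inc⟩⟩

/-- The root elations `x₇(a)` for the root opposite to that of `x₁`. -/
def x₇ (a : J) : S.collineationGroup := S.w * S.x₁ a * S.w⁻¹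

/-- `s₁(a) = x₇(a⁻¹) x₁(a) x₇(a⁻¹)`. -/
def s₁ (a : J) : S.collineationGroup := S.x₇ (S.inv a) * S.x₁ a * S.x₇ (S.inv a)

/-! ### The element `s₁(1)` is the reflection `w` -/

/-- A collineation that fixes every point `(t, a, t', a', t'')` is trivial. -/
lemma eq_one_of_fixes (g : S.collineationGroup)
    (hg : ∀ t a t' a' t'', g.1.1 (p5 t a t' a' t'') = p5 t a t' a' t'') : g = 1 := by
  have hinc := g.2
  have hl4 : ∀ t a t' a', g.1.2 (l4 t a t' a') = l4 t a t' a' := by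
    intro t a t' a'
    have h0 := (hinc (p5 t a t' a' 0) (l4 t a t' a')).2 (by simp [Inc])
    have h1 := (hinc (p5 t a t' a' 1) (l4 t a t' a')).2 (by simp [Inc])
    rw [hg] at h0 h1
    cases hm : g.1.2 (l4 t a t' a') <;> rw [hm] at h0 h1 <;> simp only [Inc] at h0 h1
    · simp [h0]
    · exact absurd (h0.2.2.2.trans h1.2.2.2.symm) (by simp)
  have hl5 : ∀ b u b' u' b'', g.1.2 (l5 b u b' u' b'') = l5 b u b' u' b'' := by
    intro b u b' u' b''
    have h0 := (hinc (p5 0 _ _ _ _) (l5 b u b' u' b'')).2 ⟨rfl, rfl, rfl, rfl⟩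
    have h1 := (hinc (p5 1 _ _ _ _) (l5 b u b' u' b'')).2 ⟨rfl, rfl, rfl, rfl⟩
    rw [hg] at h0 h1
    cases hm : g.1.2 (l5 b u b' u' b'') <;> rw [hm] at h0 h1 <;> simp only [Inc] at h0 h1
    · exact absurd (h0.1.trans h1.1.symm) (by simp)
    · obtain ⟨a0, b0, c0, d0⟩ := h0
      obtain ⟨a1, b1, c1, d1⟩ := h1
      simp only [zero_smul, sub_zero] at a0
      subst a0
      simp only [one_smul, sub_right_inj] at a1
      subst a1
      simp only [zero_smul, sub_zero, add_left_inj] at c0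
      subst c0
      simp at d0
      subst d0
      simp at b0
      subst b0
      rfl
  have hp4 : ∀ b u b' u', g.1.1 (p4 b u b' u') = p4 b u b' u' := by
    intro b u b' u'
    have h0 := (hinc (p4 b u b' u') (l5 b u b' u' 0)).2 (by simp [Inc])
    have h1 := (hinc (p4 b u b' u') (l5 b u b' u' S.one)).2 (by simp [Inc])
    rw [hl5] at h0 h1
    cases hm : g.1.1 (p4 b u b' u') <;> rw [hm] at h0 h1 <;> simp only [Inc] at h0 h1
    · simp [h0]
    · exact absurd (h0.1.symm.trans h1.1) (fun h => S.one_ne_zero.symm (sub_left_injective h))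
  have hp3 : ∀ t a t', g.1.1 (p3 t a t') = p3 t a t' := by
    intro t a t'
    have h0 := (hinc (p3 t a t') (l4 t a t' 0)).2 (by simp [Inc])
    have h1 := (hinc (p3 t a t') (l4 t a t' S.one)).2 (by simp [Inc])
    rw [hl4] at h0 h1
    cases hm : g.1.1 (p3 t a t') <;> rw [hm] at h0 h1 <;> simp only [Inc] at h0 h1
    · simp [h0]
    · exact absurd (h0.2.2.2.symm.trans h1.2.2.2) S.one_ne_zero.symm
  have hl3 : ∀ b u b', g.1.2 (l3 b u b') = l3 b u b' := by
    intro b u b'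
    have h0 := (hinc (p4 b u b' 0) (l3 b u b')).2 (by simp [Inc])
    have h1 := (hinc (p4 b u b' 1) (l3 b u b')).2 (by simp [Inc])
    rw [hp4] at h0 h1
    cases hm : g.1.2 (l3 b u b') <;> rw [hm] at h0 h1 <;> simp only [Inc] at h0 h1
    · simp [h0]
    · exact absurd (h0.2.2.2.trans h1.2.2.2.symm) (by simp)
  have hl2 : ∀ t a, g.1.2 (l2 t a) = l2 t a := by
    intro t a
    have h0 := (hinc (p3 t a 0) (l2 t a)).2 (by simp [Inc])
    have h1 := (hinc (p3 t a 1) (l2 t a)).2 (by simp [Inc])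
    rw [hp3] at h0 h1
    cases hm : g.1.2 (l2 t a) <;> rw [hm] at h0 h1 <;> simp only [Inc] at h0 h1
    · simp [h0]
    · exact absurd (h0.2.2.trans h1.2.2.symm) (by simp)
  have hp2 : ∀ b u, g.1.1 (p2 b u) = p2 b u := by
    intro b u
    have h0 := (hinc (p2 b u) (l3 b u 0)).2 (by simp [Inc])
    have h1 := (hinc (p2 b u) (l3 b u S.one)).2 (by simp [Inc])
    rw [hl3] at h0 h1
    cases hm : g.1.1 (p2 b u) <;> rw [hm] at h0 h1 <;> simp only [Inc] at h0 h1
    · simp [h0]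
    · exact absurd (h0.2.2.symm.trans h1.2.2) S.one_ne_zero.symm
  have hp1 : ∀ t, g.1.1 (p1 t) = p1 t := by
    intro t
    have h0 := (hinc (p1 t) (l2 t 0)).2 (by simp [Inc])
    have h1 := (hinc (p1 t) (l2 t S.one)).2 (by simp [Inc])
    rw [hl2] at h0 h1
    cases hm : g.1.1 (p1 t) <;> rw [hm] at h0 h1 <;> simp only [Inc] at h0 h1
    · simp [h0]
    · exact absurd (h0.2.symm.trans h1.2) S.one_ne_zero.symm
  have hl1 : ∀ b, g.1.2 (l1 b) = l1 b := by
    intro b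
    have h0 := (hinc (p2 b 0) (l1 b)).2 (by simp [Inc])
    have h1 := (hinc (p2 b 1) (l1 b)).2 (by simp [Inc])
    rw [hp2] at h0 h1
    cases hm : g.1.2 (l1 b) <;> rw [hm] at h0 h1 <;> simp only [Inc] at h0 h1
    · simp [h0]
    · exact absurd (h0.2.trans h1.2.symm) (by simp)
  have hl0 : g.1.2 l0 = l0 := by
    have h0 := (hinc (p1 0) l0).2 (by simp [Inc])
    have h1 := (hinc (p1 1) l0).2 (by simp [Inc])
    rw [hp1] at h0 h1
    cases hm : g.1.2 l0 <;> rw [hm] at h0 h1 <;> simp only [Inc] at h0 h1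
    · exact absurd (h0.trans h1.symm) (by simp)
  have hp0 : g.1.1 p0 = p0 := by
    have h0 := (hinc p0 (l1 0)).2 (by simp [Inc])
    have h1 := (hinc p0 (l1 S.one)).2 (by simp [Inc])
    rw [hl1] at h0 h1
    cases hm : g.1.1 p0 <;> rw [hm] at h0 h1 <;> simp only [Inc] at h0 h1
    · exact absurd (h0.symm.trans h1) S.one_ne_zero.symm
  apply Subtype.ext
  apply Prod.ext
  · ext p
    cases p <;> simp [hp0, hp1, hp2, hp3, hp4, hg]
  · ext l
    cases l <;> simp [hl0, hl1, hl2, hl3, hl4, hl5]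

lemma norm_one : S.norm S.one = 1 := by
  have h := S.sharp_sharp S.one
  rw [S.sharp_one, S.sharp_one] at h
  have h' : (1 : F) • S.one = S.norm S.one • S.one := by rw [one_smul]; exact h
  exact (smul_left_injective F S.one_ne_zero h').symm

lemma inv_one : S.inv S.one = S.one := by simp [inv, S.norm_one, S.sharp_one]

lemma cross_one (a : J) : S.cross S.one a = S.tr a S.one • S.one - a := by
  have h := S.eq_tr_sub a
  rw [eq_sub_iff_add_eq] at h
  rw [← h]; abel

lemma w_sq_mul_x₁ (c : J) : S.w * S.w * S.x₁ c = S.x₁ c * (S.w * S.w) := by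
  apply Subtype.ext
  apply Prod.ext
  · ext p
    change S.wPoint (S.wPoint (S.x₁Point c p)) = S.x₁Point c (S.wPoint (S.wPoint p))
    rw [S.wPoint_wPoint, S.wPoint_wPoint]
    cases p <;> simp [w2Point, x₁Point, S.sharp_neg, S.norm_neg]
    · abel
    · exact ⟨by abel, by abel, by ring⟩
  · ext l
    change S.wLine (S.wLine (S.x₁Line c l)) = S.x₁Line c (S.wLine (S.wLine l))
    rw [S.wLine_wLine, S.wLine_wLine]
    cases l <;> simp [w2Line, x₁Line, S.sharp_neg, S.norm_neg]
    · abel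
    · exact ⟨by abel, by abel⟩

lemma x₁_one_w_pow_three : (S.x₁ S.one * S.w) ^ 3 = 1 := by
  apply S.eq_one_of_fixes
  intro t a t' a' t''
  have e3 : S.tr S.one S.one = 3 := by
    have := S.tr_sharp S.one
    rwa [S.sharp_one, S.norm_one, mul_one] at this
  rw [pow_three]
  change S.x₁Point S.one (S.wPoint (S.x₁Point S.one (S.wPoint (S.x₁Point S.one (S.wPoint
    (p5 t a t' a' t'')))))) = _
  simp only [wPoint, x₁Point, S.norm_one, S.sharp_one, S.cross_one]
  have e4 : ∀ x y, S.tr S.one (S.cross x y) = S.tr x S.one * S.tr y S.one - S.tr x y := by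
    intro x y
    rw [S.tr_cross, S.cross_one]
    simp [S.tr_comm S.one y]
  have e5 : ∀ x, S.cross x S.one = S.tr x S.one • S.one - x := fun x => by
    rw [S.cross_comm, S.cross_one]
  have e6 : ∀ x, S.tr x x = S.tr x S.one ^ 2 - 2 * S.tr (S.sharp x) S.one := fun x => by
    have := e4 x x
    rw [S.cross_self, map_smul, smul_eq_mul, S.tr_comm S.one] at this
    rw [this]; ring
  simp only [HexPoint.p5.injEq, S.sharp_sub, S.sharp_add, S.sharp_smul, S.sharp_neg, S.sharp_one,
    map_sub, map_add, map_neg, map_smul, LinearMap.sub_apply, LinearMap.add_apply,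
    LinearMap.neg_apply, LinearMap.smul_apply, smul_eq_mul, e3, e4, e5, S.tr_comm S.one a,
    S.tr_comm S.one a', S.tr_comm a' a, S.tr_comm S.one (S.sharp a), e6,
    S.tr_comm S.one (S.sharp a')]
  refine ⟨by ring, by module, by ring, by module, by ring⟩

/-- `s₁(1)` is the reflection `w`; in particular it stabilises the base apartment. -/
theorem s₁_one : S.s₁ S.one = S.w := by
  have h3 := S.x₁_one_w_pow_three
  have hc := S.w_sq_mul_x₁ S.one
  have h4 : S.w * S.w * (S.w * S.w) = 1 := by
    apply Subtype.ext
    apply Prod.ext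
    · ext p
      exact S.wPoint_pow_four p
    · ext l
      exact S.wLine_pow_four l
  have hw : S.w⁻¹ = S.w * (S.w * S.w) := by
    rw [inv_eq_iff_mul_eq_one, ← h4]; group
  rw [s₁, x₇, S.inv_one, hw]
  generalize S.w = w at *
  generalize S.x₁ S.one = x at *
  have hz : w * w * w * w = 1 := by rw [← h4]; group
  calc w * x * (w * (w * w)) * x * (w * x * (w * (w * w)))
      = w * x * w * ((w * w) * x) * (w * x * (w * (w * w))) := by group
    _ = w * x * w * (x * (w * w)) * (w * x * (w * (w * w))) := by rw [hc]
    _ = w * x * w * x * w * ((w * w) * x) * (w * (w * w)) := by group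
    _ = w * x * w * x * w * (x * (w * w)) * (w * (w * w)) := by rw [hc]
    _ = w * (x * w) ^ 3 * (w * w * w * w) := by rw [pow_three]; group
    _ = w := by rw [h3, hz]; simp

end

end HexagonalSystem

/-! Since `s₁_one` identifies s₁ with `w`, the collineation is θ = h x₁(1) w. It suffices to join
each point to its image by a path of length at most four.

The heart is the generic point p = (t, a, t', a', t''). Written in U₊ relative to p, its image is k
= ⟨s, e, 0, e^h, T(e) + s⟩ (`map_p5`): the first hypothesis on h makes the x₃-entry equal to e^h,
the second makes the x₄-entry vanish. The hypotheses also give N(e^h) = N(e), T(e, e^h) = T(e^#) and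
T(e^#, (e^h)^#) = N(e) T(e). With these data a path from the base point to its image under k can be
written down. Put δ = T(e^#) + s T(e) + s². If δ = 0, the path passes through a point (b, u, b', u')
(`not_opposite_of_eq_zero`). If δ and N(e) + sδ are both nonzero, it passes through another generic
point (`not_opposite_of_ne_zero`). As N(e) + sδ = N(e + s1) and N is anisotropic, the only other
cases are e = 0 and e = -s1, both settled by short products of root elements.

For a point x = (b, u, b', u') with b ≠ 0, suppose first that the line [b] is fixed. Then N(b) = -1
(`norm_eq_neg_one`), [b] is fixed pointwise, and x and its image are both collinear with (b, u). If
[b] moves, choose a generic p collinear with x and lying on a line through a point of the image of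
the line [b, u, b'] (`exists_inc_inc`). The quartic form vanishes on the element k of p, yet it is
also the square of the difference between the x₄-coordinates of that point and of θ(x)
(`quartic_y₁_mul`). Hence the two points coincide, and p is collinear with both x and θ(x). The
remaining points are handled by direct paths; (∞) itself is fixed. -/

namespace HexagonalSystem

open HexPoint HexLine

noncomputable section

variable {F J : Type*} [Field F] [AddCommGroup J] [Module F J] (S : HexagonalSystem F J)

/-! ### Paths of length four -/

lemma incGraph_adj {p : HexPoint F J} {l : HexLine F J} (h : S.Inc p l) :
    S.incGraph.Adj (Sum.inl p) (Sum.inr l) := by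
  rw [incGraph, SimpleGraph.fromRel_adj]
  exact ⟨by simp, Or.inl ⟨p, l, rfl, rfl, h⟩⟩

/-- Two points with a common neighbour in the collinearity relation are not opposite. -/
lemma not_opposite_of_inc {p q r : HexPoint F J} {l m : HexLine F J} (h₁ : S.Inc p l)
    (h₂ : S.Inc q l) (h₃ : S.Inc q m) (h₄ : S.Inc r m) :
    ¬ S.Opposite (Sum.inl p) (Sum.inl r) := by
  intro h
  have hd := SimpleGraph.dist_le (.cons (S.incGraph_adj h₁) (.cons (S.incGraph_adj h₂).symm
    (.cons (S.incGraph_adj h₃) (.cons (S.incGraph_adj h₄).symm .nil))))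
  rw [Opposite] at h
  simp only [SimpleGraph.Walk.length_cons, SimpleGraph.Walk.length_nil] at hd
  omega

/-! ### Identities for the norm and the adjoint of a product -/

lemma sharp_cross (a b : J) : S.sharp (S.cross a b) =
    S.tr (S.sharp a) b • b + S.tr a (S.sharp b) • a - S.cross (S.sharp a) (S.sharp b) :=
  eq_sub_of_add_eq' (S.sharp_cross_sharp a b)

lemma sharp_cross_cross_right (a b : J) : S.cross (S.sharp (S.cross a b)) b =
    S.tr (S.sharp a) b • S.sharp b + S.tr a (S.sharp b) • S.cross a b
      - S.norm b • S.sharp a := by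
  have h := S.cross_cross_sharp b (S.sharp a)
  rw [S.cross_comm (S.sharp b), S.cross_comm b] at h
  rw [sharp_cross]
  simp only [map_add, map_sub, map_smul, LinearMap.add_apply, LinearMap.sub_apply,
    LinearMap.smul_apply, h, S.cross_self, S.tr_comm b]
  module

/-- Evaluate (a × b)^# × ((a × b) × a^#) in two ways: directly by `sharp_cross_cross`, and after
replacing a^# × (a × b) by N(a)b + T(a^#, b)a. Comparing the two leaves the identity multiplied by
a^#, which is nonzero when a ≠ 0. -/
lemma norm_cross (a b : J) : S.norm (S.cross a b) =
    S.tr (S.sharp a) b * S.tr a (S.sharp b) - S.norm a * S.norm b := by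
  by_cases ha : a = 0
  · subst ha; simp [S.norm_zero, S.sharp_zero]
  have h1 := S.sharp_cross_cross (S.cross a b) (S.sharp a)
  have h2 := S.sharp_cross_cross_right a b
  have h3 := S.sharp_cross_cross_right b a
  rw [S.cross_comm b a, S.tr_comm (S.sharp b), S.tr_comm b] at h3
  rw [S.cross_comm (S.cross a b) (S.sharp a), S.sharp_cross_cross, map_add, map_smul, map_smul,
    h2, h3, S.tr_comm (S.sharp (S.cross a b)), S.tr_sharp_cross] at h1
  apply smul_left_injective F (S.sharp_ne_zero ha)
  rw [← sub_eq_zero] at h1 ⊢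
  rw [← neg_eq_zero, ← h1]
  module

/-! ### Coset coordinates -/

namespace UPlus

variable {S}

/-- The point `(t, a, t', a', t'')` that stands for the coset of an element of `U₊`. -/
def toPoint (g : UPlus S) : HexPoint F J := p5 g.t g.a g.t' g.a' g.t''

/-- Forgetting the x₁-coordinate is passing to the quotient by right multiplication by U₁, so left
multiplication descends. Hence relative positions of points may be computed in U₊. -/
lemma toPoint_mul (g : UPlus S) {k k' : UPlus S} (h : k.toPoint = k'.toPoint) :
    (g * k).toPoint = (g * k').toPoint := by
  simp only [toPoint, p5.injEq] at h
  obtain ⟨h1, h2, h3, h4, h5⟩ := h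
  simp [toPoint, mul_def, h1, h2, h3, h4, h5]

lemma inc_toPoint_mul (b : J) (u : F) (b' : J) (u' : F) (b'' : J) (r : F) (c : J) :
    S.Inc (y₁ S b * y₂ S u * y₃ S b' * y₄ S u' * y₅ S b'' * y₆ S r * y₁ S c).toPoint
      (l5 b u b' u' b'') := by
  rw [toPoint, inc_iff_cosets_meet]
  refine ⟨_, r, (normal_form S _ _ _ _ _ b).trans ?_⟩
  ext <;> simp [mul_def, y₁, y₂, y₃, y₄, y₅, y₆, S.sharp_zero]

lemma exists_eq_mul (g : UPlus S) : ∃ (b : J) (u : F) (b' : J) (u' : F) (b'' : J),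
    g = y₁ S b * y₂ S u * y₃ S b' * y₄ S u' * y₅ S b'' * y₆ S g.t := by
  obtain ⟨s, e, s', e', s'', c⟩ := g
  -- Reversing the order of the root groups is a triangular system: the x₁-coordinate is read off,
  -- then those in U₅, U₃, U₂ and U₄ are solved for in turn.
  refine ⟨c, s'' + s * S.norm c - S.tr c e' + S.tr (S.sharp c) e,
    e' - S.cross c e - s • S.sharp c,
    s' + s ^ 2 * S.norm c - s * s'' - S.tr e e' + S.tr c (S.sharp e) + s * S.tr (S.sharp c) e,
    e + s • c, ?_⟩
  have q1 : S.tr (S.cross c e) e = 2 * S.tr c (S.sharp e) := by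
    rw [← S.tr_cross, S.cross_self]; simp
  have q2 : S.tr (S.cross c e) c = 2 * S.tr (S.sharp c) e := by
    rw [S.tr_comm, S.tr_cross_self]
  ext <;> simp [mul_def, y₁, y₂, y₃, y₄, y₅, y₆, S.sharp_zero, S.sharp_add,
    S.sharp_smul, S.cross_self, S.tr_sharp, S.tr_sharp', S.tr_cross_self, S.tr_cross_self',
    S.tr_comm e' e, S.tr_comm e' c, q1, q2]
  all_goals first | ring1 | module

/-- For every `g` in `U₊` the points of the cosets `g x₅(d) x₆(r)` lie on lines through a common
point `(b, u, b', u')`. -/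
lemma exists_inc (g : UPlus S) : ∃ (b : J) (u : F) (b' : J) (u' : F) (b'' : J), ∀ (d : J) (r : F)
    (c : J), S.Inc (g * y₅ S d * y₆ S r * y₁ S c).toPoint (l5 b u b' u' (b'' + d)) := by
  obtain ⟨b, u, b', u', b'', h⟩ := g.exists_eq_mul
  refine ⟨b, u, b', u', b'', fun d r c => ?_⟩
  -- U₅ and U₆ commute, so right multiplication by x₅(d)x₆(r) changes only the last two factors of
  -- the reversed normal form.
  have h56 : y₆ S g.t * y₅ S d * y₆ S r = y₅ S d * y₆ S (g.t + r) := by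
    ext <;> simp [mul_def, y₅, y₆, S.sharp_zero, S.norm_zero]
  have h55 : y₅ S b'' * y₅ S d = y₅ S (b'' + d) := by
    ext <;> simp [mul_def, y₅, S.sharp_zero, S.norm_zero]
  have := inc_toPoint_mul (S := S) b u b' u' (b'' + d) (g.t + r) c
  rw [h]
  simp only [mul_assoc] at this h56 ⊢
  rwa [← mul_assoc (y₅ S d), ← mul_assoc (y₆ S g.t), h56, mul_assoc (y₅ S d),
    ← mul_assoc (y₅ S b''), h55]

lemma y₁_zero : y₁ S 0 = 1 := rfl
lemma y₅_zero : y₅ S 0 = 1 := rfl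
lemma y₆_zero : y₆ S 0 = 1 := rfl

lemma y₁_mul_y₁_neg (c : J) : y₁ S c * y₁ S (-c) = 1 := by
  rw [← y₁_zero]
  ext <;> simp [mul_def, y₁, S.sharp_zero]

/-- The points of the cosets of `g` and `g x₁(b) x₆(t)` are collinear. -/
lemma exists_inc_inc (g : UPlus S) (b : J) (t : F) : ∃ l : HexLine F J,
    S.Inc g.toPoint l ∧ S.Inc (g * y₁ S b * y₆ S t).toPoint l := by
  obtain ⟨_, _, _, _, _, h⟩ := (g * y₁ S b).exists_inc
  have h1 := h 0 0 (-b)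
  have h2 := h 0 t 0
  rw [y₅_zero, y₆_zero, mul_one, mul_one, mul_assoc, y₁_mul_y₁_neg, mul_one] at h1
  rw [y₅_zero, y₁_zero, mul_one, mul_one] at h2
  exact ⟨_, h1, h2⟩

lemma not_opposite_of_two_steps (g : UPlus S) (b c : J) (t r : F) :
    ¬ S.Opposite (Sum.inl g.toPoint)
      (Sum.inl (g * (y₁ S b * y₆ S t * y₁ S c * y₆ S r)).toPoint) := by
  obtain ⟨l, h1, h2⟩ := g.exists_inc_inc b t
  obtain ⟨m, h3, h4⟩ := (g * y₁ S b * y₆ S t).exists_inc_inc c r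
  refine S.not_opposite_of_inc h1 h2 h3 ?_
  simpa only [mul_assoc] using h4

/-- Both points lie on lines [b, u, b', u', ·], which all pass through (b, u, b', u'). -/
lemma not_opposite_of_mul_y₅ (g : UPlus S) (c d : J) (r : F) :
    ¬ S.Opposite (Sum.inl g.toPoint)
      (Sum.inl (g * (y₁ S c * y₅ S d * y₆ S r)).toPoint) := by
  obtain ⟨b, u, b', u', b'', h⟩ := (g * y₁ S c).exists_inc
  have h1 := h 0 0 (-c)
  have h2 := h d r 0
  rw [y₅_zero, y₆_zero, mul_one, mul_one, mul_assoc, y₁_mul_y₁_neg, mul_one] at h1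
  rw [y₁_zero, mul_one] at h2
  refine S.not_opposite_of_inc (q := p4 b u b' u') h1 (by simp [Inc]) (m := l5 b u b' u' (b'' + d))
    (by simp [Inc]) ?_
  simpa only [mul_assoc] using h2

lemma exists_inc_of_mul_y₂ (g : UPlus S) (hg : g.c = 0) (t : F) : ∃ l : HexLine F J,
    S.Inc g.toPoint l ∧ S.Inc (g * y₂ S t).toPoint l :=
  ⟨l4 g.t g.a g.t' g.a', by simp [toPoint, Inc], by
    simp [toPoint, Inc, mul_def, y₂, hg, S.sharp_zero, S.norm_zero]⟩

end UPlus

/-! ### Points at distance at most four from `(0, 0, 0, 0, 0)` -/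

section Transversal

variable {S} {e e₁ c : J} {s σ τ : F} (he : e ≠ 0) (hN : S.norm e₁ = S.norm e)
  (hσ : S.tr e e₁ = σ) (hτ : S.tr (S.sharp e) (S.sharp e₁) = S.norm e * τ)
  (hc : S.norm e • c = S.cross (S.sharp e) e₁ + s • S.sharp e₁)

-- This and the next four lemmas express the data of c = N(e)⁻¹(e^# × e₁ + s e₁^#) through e and e₁.
-- In both path constructions below, c is the first coordinate of the line of the path that passes
-- through the far point. The quantity δ = σ + sτ + s² controls everything; in particular the
-- formulas for e × c and c^# combine to N(e)(e × c + s c^#) = (N(e) + sδ)e₁ + δ e^#.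
include hσ hc in
lemma norm_smul_cross_transversal : S.norm e • S.cross e c =
    S.norm e • e₁ + σ • S.sharp e + s • S.cross e (S.sharp e₁) := by
  rw [← map_smul, hc, map_add, S.cross_cross_sharp, hσ, map_smul]

include he hN hσ hτ hc in
lemma norm_smul_sharp_transversal : S.norm e • S.sharp c =
    (σ + s * τ + s ^ 2) • e₁ + (τ + s) • S.sharp e - S.cross e (S.sharp e₁) := by
  have hn := S.norm_ne_zero he
  have h1 := congrArg S.sharp hc
  have h2 := S.sharp_cross_cross e₁ (S.sharp e)
  rw [S.cross_comm e₁, S.cross_comm, S.tr_comm, hτ, hN] at h2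
  rw [S.sharp_smul, S.sharp_add, S.sharp_smul, map_smul, h2, S.sharp_cross, S.sharp_sharp,
    S.sharp_sharp, hτ, hN] at h1
  simp only [map_smul, LinearMap.smul_apply, smul_eq_mul, hσ] at h1
  apply smul_right_injective J hn
  simp only
  rw [smul_smul, ← pow_two, h1]
  module

include he hN hσ hτ hc in
lemma norm_mul_norm_transversal : S.norm e * S.norm c =
    (τ + s) * (σ + s * τ + s ^ 2) - S.norm e := by
  have hn := S.norm_ne_zero he
  have h1 := congrArg S.norm hc
  have h2 : S.tr (S.cross e (S.sharp e₁)) (S.sharp e₁) = 2 * (S.norm e * σ) := by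
    rw [← S.tr_cross, S.cross_self, S.sharp_sharp, hN]
    simp [hσ]
  have h3 : S.tr (S.cross (S.sharp e) e₁) e₁ = 2 * (S.norm e * τ) := by
    rw [← S.tr_cross, S.cross_self]
    simp [hτ]
  rw [S.norm_smul, S.norm_add, S.norm_smul, S.sharp_smul, S.norm_sharp, S.norm_cross,
    S.sharp_cross, S.norm_sharp, S.sharp_sharp, S.sharp_sharp, hτ, hN] at h1
  simp only [map_smul, map_sub, map_add, LinearMap.smul_apply, LinearMap.sub_apply,
    LinearMap.add_apply, smul_eq_mul, hσ, hτ, h2, h3, S.tr_sharp, hN] at h1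
  apply mul_left_cancel₀ (pow_ne_zero 2 hn)
  linear_combination h1

include he hσ hτ hc in
lemma tr_sharp_transversal : S.tr (S.sharp e) c = 2 * σ + s * τ := by
  have hn := S.norm_ne_zero he
  have h1 := congrArg (S.tr (S.sharp e)) hc
  rw [map_add, S.tr_cross_self, S.sharp_sharp] at h1
  simp only [map_smul, LinearMap.smul_apply, smul_eq_mul, hσ, hτ] at h1
  apply mul_left_cancel₀ hn
  linear_combination h1

include he hN hσ hτ hc in
lemma norm_mul_tr_sharp_transversal : S.norm e * S.tr e (S.sharp c) =
    σ * (σ + s * τ + s ^ 2) + S.norm e * (τ + 3 * s) := by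
  have h1 := congrArg (S.tr e) (norm_smul_sharp_transversal he hN hσ hτ hc)
  simp only [map_smul, map_sub, map_add, smul_eq_mul, hσ, hτ, S.tr_cross_self, S.tr_sharp] at h1
  linear_combination h1

end Transversal

namespace UPlus

variable {S}

lemma toPoint_two_steps (b c : J) (t r : F) :
    (y₁ S b * y₆ S t * y₁ S (c - b) * y₆ S r).toPoint =
      p5 (t + r) (-(t • b + r • c))
        (t ^ 2 * S.norm b + r ^ 2 * S.norm c + t * r * (S.tr c (S.sharp b) - S.norm b))
        (-(t • S.sharp b + r • S.sharp c)) (-(t * S.norm b + r * S.norm c)) := by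
  simp [toPoint, mul_def, y₁, y₆, S.sharp_zero, S.tr_comm (S.sharp b) c]
  refine ⟨by module, by ring, by module, by ring⟩

lemma toPoint_mul_y₅ (c d : J) (r : F) :
    (y₁ S c * y₅ S d * y₆ S r).toPoint =
      p5 r (d - r • c) (r ^ 2 * S.norm c - r * S.tr (S.sharp c) d + S.tr c (S.sharp d))
        (S.cross c d - r • S.sharp c) (S.tr (S.sharp c) d - r * S.norm c) := by
  have q : S.tr (S.cross c d) c = 2 * S.tr (S.sharp c) d := by rw [S.tr_comm, S.tr_cross_self]
  simp [toPoint, mul_def, y₁, y₅, y₆, S.sharp_zero, q]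
  refine ⟨by module, by ring, by module, by ring⟩

section Transversal

variable {e e₁ : J} {s σ τ : F} (he : e ≠ 0) (hN : S.norm e₁ = S.norm e)
  (hσ : S.tr e e₁ = σ) (hτ : S.tr (S.sharp e) (S.sharp e₁) = S.norm e * τ)

-- For δ = 0 one gets N(c) = -1 and e × c + s c^# = e₁. These make the given element agree, modulo
-- U₁, with x₁(c) x₅(e + sc) x₆(s).
include he hN hσ hτ in
lemma not_opposite_of_eq_zero (hδ : σ + s * τ + s ^ 2 = 0) (g : UPlus S) :
    ¬ S.Opposite (Sum.inl g.toPoint) (Sum.inl (g * ⟨s, e, 0, e₁, τ + s, 0⟩ : UPlus S).toPoint) := by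
  have hn := S.norm_ne_zero he
  obtain ⟨c, hc⟩ : ∃ c, S.norm e • c = S.cross (S.sharp e) e₁ + s • S.sharp e₁ :=
    ⟨(S.norm e)⁻¹ • _, smul_inv_smul₀ hn _⟩
  have h1 := norm_smul_cross_transversal hσ hc
  have h2 := norm_smul_sharp_transversal he hN hσ hτ hc
  have h3 := norm_mul_norm_transversal he hN hσ hτ hc
  have h4 := tr_sharp_transversal he hσ hτ hc
  have h5 := norm_mul_tr_sharp_transversal he hN hσ hτ hc
  rw [hδ] at h2 h3 h5
  have h3' : S.norm c = -1 := mul_left_cancel₀ hn (by linear_combination h3)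
  have h5' : S.tr e (S.sharp c) = τ + 3 * s := mul_left_cancel₀ hn (by linear_combination h5)
  have h6 : S.cross e c + s • S.sharp c = e₁ := by
    apply smul_right_injective J hn
    simp only
    have : S.norm e • (S.cross e c + s • S.sharp c)
        = S.norm e • e₁ + (σ + s * τ + s ^ 2) • S.sharp e := by
      rw [smul_add, h1, smul_comm, h2]; module
    rw [this, hδ]; module
  rw [g.toPoint_mul (k' := y₁ S c * y₅ S (e + s • c) * y₆ S s)]
  · exact g.not_opposite_of_mul_y₅ c _ s
  rw [toPoint_mul_y₅, toPoint, p5.injEq]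
  simp only [S.sharp_add, S.sharp_smul, map_add, map_smul, S.cross_self, S.tr_sharp,
    S.tr_sharp', S.tr_cross_self', smul_eq_mul, S.tr_comm c (S.sharp e),
    S.tr_comm (S.sharp c) e, h3', h4, h5', S.cross_comm c e]
  refine ⟨trivial, by module, by linear_combination -2 * hδ, ?_, by ring⟩
  rw [← h6]; module

-- The given element is matched, modulo U₁, with x₁(b) x₆(t) x₁(c - b) x₆(r), that is, with two
-- steps of collinearity through generic points. The x₆- and x₅-entries demand t + r = s and tb + rc
-- = -e; the choice of c takes care of the rest.
include he hN hσ hτ in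
lemma not_opposite_of_ne_zero (hδ : σ + s * τ + s ^ 2 ≠ 0)
    (ht : S.norm e + s * (σ + s * τ + s ^ 2) ≠ 0) (g : UPlus S) :
    ¬ S.Opposite (Sum.inl g.toPoint) (Sum.inl (g * ⟨s, e, 0, e₁, τ + s, 0⟩ : UPlus S).toPoint) := by
  have hn := S.norm_ne_zero he
  obtain ⟨c, hc⟩ : ∃ c, S.norm e • c = S.cross (S.sharp e) e₁ + s • S.sharp e₁ :=
    ⟨(S.norm e)⁻¹ • _, smul_inv_smul₀ hn _⟩
  have h1 := norm_smul_cross_transversal hσ hc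
  have h2 := norm_smul_sharp_transversal he hN hσ hτ hc
  have h3 := norm_mul_norm_transversal he hN hσ hτ hc
  have h4 := tr_sharp_transversal he hσ hτ hc
  have h5 := norm_mul_tr_sharp_transversal he hN hσ hτ hc
  obtain ⟨δ, hδe⟩ : ∃ δ, δ = σ + s * τ + s ^ 2 := ⟨_, rfl⟩
  rw [← hδe] at hδ ht h2 h3 h5
  -- After elimination of b, the x₃-entry demands t e₁ + e^# + r(e × c + s c^#) = 0. Since N(e)(e ×
  -- c + s c^#) = (N(e) + sδ)e₁ + δ e^#, comparing coefficients gives this r and the next t.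
  obtain ⟨r, hr⟩ : ∃ r, r = -S.norm e / δ := ⟨_, rfl⟩
  obtain ⟨t, htd⟩ : ∃ t, t = (S.norm e + s * δ) / δ := ⟨_, rfl⟩
  have ht0 : t ≠ 0 := by rw [htd]; exact div_ne_zero ht hδ
  have hrt : t + r = s := by rw [hr, htd]; field_simp; ring
  have hrδ : r * δ = -S.norm e := by rw [hr]; field_simp
  obtain ⟨b, hb⟩ : ∃ b, b = -(t⁻¹ • (e + r • c)) := ⟨_, rfl⟩
  have hb1 : t • b = -(e + r • c) := by rw [hb, smul_neg, smul_inv_smul₀ ht0]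
  have hb2 : t ^ 2 • S.sharp b = S.sharp e + r • S.cross e c + r ^ 2 • S.sharp c := by
    rw [← S.sharp_smul, hb1, S.sharp_neg, S.sharp_add, S.sharp_smul, map_smul]
  have hb3 : t ^ 3 * S.norm b = -(S.norm e + r * S.tr (S.sharp e) c
      + r ^ 2 * S.tr e (S.sharp c) + r ^ 3 * S.norm c) := by
    rw [← S.norm_smul, hb1, S.norm_neg, S.norm_add, S.norm_smul, S.sharp_smul]
    simp
  have hb4 : t ^ 2 * S.tr c (S.sharp b) = S.tr (S.sharp e) c + 2 * r * S.tr e (S.sharp c)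
      + 3 * r ^ 2 * S.norm c := by
    rw [← smul_eq_mul, ← map_smul, hb2]
    simp only [map_add, map_smul, smul_eq_mul, S.tr_cross_self', S.tr_sharp,
      S.tr_comm c (S.sharp e), S.tr_comm e (S.sharp c)]
    ring
  -- This is the x₃-equation multiplied by t, with t²b^# expanded through tb = -(e + rc).
  have hb5 : t • e₁ + S.sharp e + r • S.cross e c + (r * s) • S.sharp c = 0 := by
    apply smul_right_injective J hδ
    simp only
    have : δ • (t • e₁ + S.sharp e + r • S.cross e c + (r * s) • S.sharp c)
        = (δ * t) • e₁ + δ • S.sharp e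
          + (r * δ) • S.cross e c + (s * (r * δ)) • S.sharp c := by module
    rw [this, hrδ, mul_neg, neg_smul, neg_smul, mul_smul s, h1, h2, htd, mul_div_cancel₀ _ hδ]
    rw [smul_zero, hδe]
    module
  have hNc : r * S.norm c = -(τ + s) - r := by
    apply mul_left_cancel₀ hδ
    linear_combination (S.norm c + 1) * hrδ - h3
  have hTc : r * S.tr e (S.sharp c) = -σ + r * (τ + 3 * s) := by
    apply mul_left_cancel₀ hδ
    linear_combination (S.tr e (S.sharp c) - (τ + 3 * s)) * hrδ - h5
  have hNb : t * S.norm b = r := by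
    apply mul_left_cancel₀ (pow_ne_zero 2 ht0)
    subst hδe
    obtain rfl : s = t + r := hrt.symm
    linear_combination hb3 - r * h4 - r * hTc - r ^ 2 * hNc - hrδ
  have hTb : t * S.tr c (S.sharp b) = τ + 3 * r := by
    apply mul_left_cancel₀ ht0
    obtain rfl : s = t + r := hrt.symm
    linear_combination hb4 + h4 + 2 * hTc + 3 * r * hNc
  rw [g.toPoint_mul (k' := y₁ S b * y₆ S t * y₁ S (c - b) * y₆ S r)]
  · exact g.not_opposite_of_two_steps b _ t r
  rw [toPoint_two_steps, toPoint, p5.injEq]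
  refine ⟨hrt.symm, by rw [hb1]; module, ?_, ?_, ?_⟩
  · obtain rfl : s = t + r := hrt.symm
    linear_combination -(t - r) * hNb - r * hNc - r * hTb
  · apply smul_right_injective J ht0
    have : t • -(t • S.sharp b + r • S.sharp c)
        = -(t ^ 2 • S.sharp b) - (r * t) • S.sharp c := by module
    simp only
    rw [this, hb2]
    obtain rfl : t = s - r := eq_sub_of_add_eq hrt
    rw [← sub_eq_zero, ← hb5]
    module
  · linear_combination hNb + hNc

end Transversal

end UPlus

/-! ### The quartic form of `U₊` -/

namespace UPlus

variable {S}

/-- The polynomial function on `U₊` whose zeros are the elements that do not map the point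
`(0, 0, 0, 0, 0)` to an opposite point. -/
def quartic (k : UPlus S) : F :=
  k.t' ^ 2 - k.t' * (k.t * k.t'' + S.tr k.a k.a') + k.t * S.norm k.a' - k.t'' * S.norm k.a
    + S.tr (S.sharp k.a) (S.sharp k.a')

lemma quartic_congr {k k' : UPlus S} (h : k.toPoint = k'.toPoint) : k.quartic = k'.quartic := by
  simp only [toPoint, p5.injEq] at h
  obtain ⟨h1, h2, h3, h4, h5⟩ := h
  simp [quartic, h1, h2, h3, h4, h5]

/-- Two generic points on lines [B, U, B', X, ·] and [B, U, B', X', ·] differ by such an element,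
modulo U₁, with ξ = X' - X. Thus the form detects whether these lines pass through the same point of
[B, U, B']. -/
lemma quartic_y₁_mul (c d : J) (r ξ : F) :
    (y₁ S c * ⟨r, d, ξ, 0, 0, 0⟩ : UPlus S).quartic = ξ ^ 2 := by
  have q1 : S.tr d (S.cross c d) = 2 * S.tr c (S.sharp d) := by
    rw [S.tr_cross_self', S.tr_comm]
  have q2 : S.tr (S.sharp c) (S.sharp (S.cross c d))
      = S.tr (S.sharp c) d ^ 2 + S.norm c * S.tr c (S.sharp d) := S.tr_sharp_cross c d
  have q3 : S.tr (S.sharp d) (S.sharp (S.cross c d))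
      = S.tr c (S.sharp d) ^ 2 + S.norm d * S.tr (S.sharp c) d := by
    rw [S.cross_comm, S.tr_sharp_cross, S.tr_comm d, S.tr_comm (S.sharp d)]
  have q4 : S.cross (S.cross c d) (S.sharp c) = S.norm c • d + S.tr (S.sharp c) d • c := by
    rw [S.cross_comm, S.sharp_cross_cross]
  have q5 : S.tr (S.cross d c) (S.sharp (S.cross c d)) = 3 * S.norm (S.cross c d) := by
    rw [S.cross_comm, S.tr_sharp]
  have q6 : S.tr (S.sharp (S.cross c d)) (S.sharp c)
      = S.tr (S.sharp c) d ^ 2 + S.norm c * S.tr c (S.sharp d) := by rw [S.tr_comm, q2]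
  have q7 : S.tr (S.cross c d) c = 2 * S.tr (S.sharp c) d := by
    rw [S.tr_comm, S.tr_cross_self]
  have q8 : S.tr (S.cross d c) d = 2 * S.tr c (S.sharp d) := by
    rw [S.tr_comm, S.cross_comm, q1]
  have q9 : S.tr (S.cross d c) c = 2 * S.tr (S.sharp c) d := by
    rw [S.tr_comm, S.tr_cross_self']
  have e : (y₁ S c * ⟨r, d, ξ, 0, 0, 0⟩ : UPlus S) = ⟨r, d - r • c,
      ξ + (r ^ 2 * S.norm c - r * S.tr (S.sharp c) d + S.tr c (S.sharp d)),
      S.cross c d - r • S.sharp c, S.tr (S.sharp c) d - r * S.norm c, c⟩ := by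
    ext <;> simp [mul_def, y₁] <;> ring
  rw [e]
  simp only [quartic, S.sharp_smul, sub_eq_add_neg (S.cross c d),
    sub_eq_add_neg d, S.sharp_add, S.norm_add, S.sharp_neg, S.norm_neg, S.norm_smul,
    map_neg, map_add, map_smul, LinearMap.add_apply,
    LinearMap.neg_apply, LinearMap.smul_apply, smul_eq_mul, S.norm_cross, S.norm_sharp, q1, q2,
    q3, q4, q5, q6, q7, q8, q9, S.tr_comm d (S.sharp c), S.tr_comm (S.sharp d) c,
    S.tr_cross_self, S.tr_sharp, S.tr_sharp', S.sharp_sharp]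
  ring

end UPlus

/-- If `B ≠ b`, then some line through `(b, u, b', u')` meets a line through one of the points
`(B, U, B', X)`. -/
lemma exists_inc_inc {b B : J} (hB : B ≠ b) (u : F) (b' : J) (u' U : F) (B' : J) :
    ∃ (t : F) (a : J) (t' : F) (a' : J) (t'' : F) (b'' : J) (X : F) (B'' : J),
      S.Inc (p5 t a t' a' t'') (l5 b u b' u' b'') ∧
      S.Inc (p5 t a t' a' t'') (l5 B U B' X B'') := by
  suffices key : ∀ D : J, D ≠ 0 → ∃ (t : F) (a : J) (t' : F) (a' : J) (t'' : F) (b'' : J) (X : F)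
      (B'' : J), S.Inc (p5 t a t' a' t'') (l5 0 u b' u' b'') ∧
      S.Inc (p5 t a t' a' t'') (l5 D U B' X B'') by
    -- Left multiplication by x₁(b) shifts only the first coordinate of the lines concerned, so the
    -- case b = 0 suffices.
    obtain ⟨t, a, t', a', t'', b'', X, B'', h1, h2⟩ := key (B - b) (sub_ne_zero.2 hB)
    have h1' := S.x₁_inc b h1
    have h2' := S.x₁_inc b h2
    simp only [x₁Line, zero_add, sub_add_cancel] at h1' h2'
    exact ⟨_, _, _, _, _, _, _, _, h1', h2'⟩
  intro D hD
  have hn := S.norm_ne_zero hD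
  -- The incidences amount to `e1` and `e2`, since X is free to absorb the x₄-equation. Pairing `e1`
  -- with D and inserting `e2` yields t; applying D^# × to `e1` then yields B''.
  obtain ⟨t, ht⟩ : ∃ t, t = (S.norm D)⁻¹ * (2 * (u - U) - S.tr D (b' + B')) := ⟨_, rfl⟩
  obtain ⟨B'', hB''⟩ : ∃ B'', B'' = (S.norm D)⁻¹ •
    (S.cross (S.sharp D) (b' - B') + (u - U - S.tr D b') • D) := ⟨_, rfl⟩
  have e1 : S.cross D B'' = b' - B' + t • S.sharp D := by
    rw [hB'', ht]
    simp only [map_smul, map_add, S.cross_cross_sharp, S.cross_self, map_sub]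
    match_scalars <;> field_simp
    ring
  have e2 : S.tr B'' (S.sharp D) = u - U + t * S.norm D - S.tr D B' := by
    rw [S.tr_comm, hB'', ht]
    simp only [map_smul, map_add, S.tr_cross_self, S.sharp_sharp, LinearMap.smul_apply,
      S.tr_sharp', smul_eq_mul, map_sub]
    field_simp
    ring
  refine ⟨t, B'' - t • D, u' + u * t + S.tr b' (B'' - t • D), b', u, B'' - t • D,
    u' + u * t + S.tr b' (B'' - t • D) - (t ^ 2 * S.norm D + U * t - t * S.tr B'' (S.sharp D)
      + S.tr B' B'' + S.tr (S.sharp B'') D), B'', ⟨by simp, ?_, ?_, ?_⟩, ⟨rfl, by ring, ?_, ?_⟩⟩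
  · simp [S.norm_zero, S.sharp_zero]
  · simp [S.sharp_zero]
  · simp [S.norm_zero, S.sharp_zero]
  · rw [e1]; module
  · rw [e2]; ring

/-! ### The collineation `h x₁(1) w` -/

section Domestic

variable {S} {h : J ≃ₗ[F] J} (hh : S.IsAut h)
  (hT : ∀ a : J, S.trace a • S.one = a + h a + h (h a))
  (hT' : ∀ a : J, S.trace (S.sharp a) = S.tr a (h a))

lemma trace_one : S.trace S.one = 3 := by
  have := S.tr_sharp S.one
  rwa [S.sharp_one, S.norm_one, mul_one] at this

lemma norm_add_smul_one (a : J) (s : F) : S.norm (a + s • S.one) =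
    S.norm a + s * S.trace (S.sharp a) + s ^ 2 * S.trace a + s ^ 3 := by
  rw [S.norm_add, S.sharp_smul, S.norm_smul, S.norm_one, S.sharp_one]
  simp [trace]

-- The trace condition at a = 1 gives T(1^h) = 3. As 1^h is its own adjoint and has norm 1, N(1^h -
-- 1) = 1 - 3 + 3 - 1 = 0, and anisotropy applies.
include hh hT' in
lemma isAut_one : h S.one = S.one := by
  have h1 : S.trace (h S.one) = 3 := by
    rw [trace, S.tr_comm, ← hT', S.sharp_one, trace_one]
  have h2 := norm_add_smul_one (S := S) (h S.one) (-1)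
  rw [← hh, S.sharp_one, S.isAut_norm hh, S.norm_one, h1] at h2
  have h3 := (S.norm_eq_zero_iff _).1 (h2.trans (by ring))
  rwa [neg_smul, one_smul, ← sub_eq_add_neg, sub_eq_zero] at h3

include hh hT' in
lemma isAut_trace (a : J) : S.trace (h a) = S.trace a := by
  have := S.isAut_tr hh a S.one
  rwa [isAut_one hh hT'] at this

-- This is the second trace condition applied to a^#, because a^## = N(a)a.
include hh hT' in
lemma tr_sharp_sharp_isAut (a : J) :
    S.tr (S.sharp a) (S.sharp (h a)) = S.norm a * S.trace a := by
  rw [← hh, ← hT', S.sharp_sharp, trace, trace, map_smul]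
  rfl

include hh hT hT' in
/-- The point `(t, a, t', a', t'')` and its image differ by an element of `U₊` with trivial
`x₄`-coordinate. -/
lemma map_p5 (t : F) (a : J) (t' : F) (a' : J) (t'' : F) : ∃ e : J,
    autPoint h (S.x₁Point S.one (S.wPoint (p5 t a t' a' t''))) =
      (⟨t, a, t', a', t'', 0⟩ * ⟨t'' - t, e, 0, h e, S.trace e + (t'' - t), 0⟩ :
        UPlus S).toPoint := by
  have h1 := isAut_one hh hT'
  have h2 := isAut_trace hh hT' a'
  have h3 := hT a'
  have h4 := hT' a'
  have h5 := trace_one (S := S)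
  unfold trace at h2 h3 h4 h5
  -- The x₅-entry forces this e. The x₃-entry becomes e^h by T(a')1 = a' + a'^h + a'^(h²), and the
  -- x₄-entry cancels by T(a'^#) = T(a', a'^h).
  refine ⟨h a' - t'' • S.one - a, ?_⟩
  simp only [wPoint, x₁Point, autPoint, UPlus.toPoint, UPlus.mul_def, S.norm_one, S.sharp_one,
    S.norm_zero, S.sharp_zero, map_sub, map_add, map_neg, map_smul, S.cross_one, h1, p5.injEq,
    trace, map_zero, LinearMap.zero_apply, LinearMap.sub_apply, LinearMap.smul_apply, h2, h5,
    S.tr_comm S.one, h4, S.tr_comm a' a, smul_eq_mul, smul_zero, LinearMap.neg_apply]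
  refine ⟨by ring, by module, by ring, ?_, by ring⟩
  rw [h3]
  module

include hh hT' in
lemma quartic_eq_zero (e : J) (s : F) :
    (⟨s, e, 0, h e, S.trace e + s, 0⟩ : UPlus S).quartic = 0 := by
  simp only [UPlus.quartic, tr_sharp_sharp_isAut hh hT', S.isAut_norm hh]
  ring

include hh hT hT' in
lemma not_opposite_map_p5 (t : F) (a : J) (t' : F) (a' : J) (t'' : F) :
    ¬ S.Opposite (Sum.inl (p5 t a t' a' t''))
      (Sum.inl (autPoint h (S.x₁Point S.one (S.wPoint (p5 t a t' a' t''))))) := by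
  obtain ⟨e, he⟩ := map_p5 hh hT hT' t a t' a' t''
  rw [he]
  generalize t'' - t = s
  obtain ⟨g, hg⟩ : ∃ g : UPlus S, g = ⟨t, a, t', a', t'', 0⟩ := ⟨_, rfl⟩
  have hgc : g.c = 0 := by rw [hg]
  have hgp : p5 t a t' a' t'' = g.toPoint := by rw [hg]; rfl
  rw [hgp, ← hg]
  by_cases he0 : e = 0
  -- Here the relative element is x₆(s)x₂(s), and each factor moves along one line.
  · subst he0
    obtain ⟨l, h1, h2⟩ := g.exists_inc_inc 0 s
    rw [UPlus.y₁_zero, mul_one] at h2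
    obtain ⟨m, h3, h4⟩ := (g * UPlus.y₆ S s).exists_inc_of_mul_y₂
      (by simp [UPlus.mul_def, UPlus.y₆, hgc]) s
    refine S.not_opposite_of_inc h1 h2 h3 ?_
    rw [g.toPoint_mul (k' := UPlus.y₆ S s * UPlus.y₂ S s), ← mul_assoc]
    · exact h4
    · simp [UPlus.toPoint, UPlus.mul_def, UPlus.y₆, UPlus.y₂, S.sharp_zero, S.norm_zero, trace]
  have hN := S.isAut_norm hh e
  have hτ := tr_sharp_sharp_isAut hh hT' e
  have hσ := (hT' e).symm
  by_cases hδ : S.trace (S.sharp e) + s * S.trace e + s ^ 2 = 0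
  · exact UPlus.not_opposite_of_eq_zero he0 hN hσ hτ hδ g
  -- The left side is N(e + s1), so its vanishing means e = -s1. The relative element is then
  -- x₂(-s)x₁(1)x₆(s) modulo U₁, again two steps.
  by_cases ht : S.norm e + s * (S.trace (S.sharp e) + s * S.trace e + s ^ 2) = 0
  · have h1 : e = -(s • S.one) := by
      rw [eq_neg_iff_add_eq_zero, ← S.norm_eq_zero_iff, norm_add_smul_one, ← ht]
      ring
    have h2 : S.trace e = -(3 * s) := by
      rw [h1, trace, map_neg, map_smul, LinearMap.neg_apply, LinearMap.smul_apply, smul_eq_mul,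
        ← trace, trace_one]
      ring
    obtain ⟨l, h3, h4⟩ := g.exists_inc_of_mul_y₂ hgc (-s)
    obtain ⟨m, h5, h6⟩ := (g * UPlus.y₂ S (-s)).exists_inc_inc S.one s
    refine S.not_opposite_of_inc h3 h4 h5 ?_
    rw [g.toPoint_mul (k' := UPlus.y₂ S (-s) * (UPlus.y₁ S S.one * UPlus.y₆ S s)), ← mul_assoc,
      ← mul_assoc]
    · exact h6
    · rw [h2, h1]
      simp [UPlus.toPoint, UPlus.mul_def, UPlus.y₁, UPlus.y₆, UPlus.y₂, S.sharp_zero, S.norm_zero,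
        S.norm_one, S.sharp_one, isAut_one hh hT']
      refine ⟨by ring, by ring⟩
  · exact UPlus.not_opposite_of_ne_zero he0 hN hσ hτ hδ ht g

-- The image is (1, -t, -a^h, t'). A generic point on a line through (t, a, t') also lies on a line
-- through the image: the entry a + t1 is forced, and the one remaining equation, for the
-- x₄-coordinate, is the second trace condition.
include hh hT' in
lemma not_opposite_map_p3 (t : F) (a : J) (t' : F) :
    ¬ S.Opposite (Sum.inl (p3 t a t'))
      (Sum.inl (autPoint h (S.x₁Point S.one (S.wPoint (p3 t a t'))))) := by
  have h1 := isAut_one hh hT'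
  have h2 := isAut_trace hh hT' a
  have h3 := hT' a
  have h4 := trace_one (S := S)
  unfold trace at h2 h3 h4
  simp only [wPoint, x₁Point, autPoint, zero_add, map_neg, h1]
  refine S.not_opposite_of_inc (l := l4 t a t' _) (m := l5 S.one (-t) (-h a) t' (a + t • S.one))
    ⟨rfl, rfl, rfl⟩ (q := p5 t a t' _ _) ⟨rfl, rfl, rfl, rfl⟩ ⟨by module, ?_, rfl, rfl⟩
    ⟨rfl, rfl, rfl, rfl⟩
  simp only [S.norm_one, S.sharp_one, S.sharp_add, S.sharp_smul, map_add, map_neg, map_smul,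
    LinearMap.add_apply, LinearMap.neg_apply, LinearMap.smul_apply, smul_eq_mul, h2, h3, h4,
    S.tr_comm (h a) a, S.cross_comm a, S.cross_one, LinearMap.sub_apply, map_sub]
  ring

-- Here `w` takes the first branch and the image has the form (u, b'^h - u1, ·). The linking point
-- is generic, and its x₄-equation is once more the second trace condition.
include hh hT' in
lemma not_opposite_map_p4_zero (u : F) (b' : J) (u' : F) :
    ¬ S.Opposite (Sum.inl (p4 0 u b' u'))
      (Sum.inl (autPoint h (S.x₁Point S.one (S.wPoint (p4 0 u b' u'))))) := by
  have h1 := isAut_one hh hT'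
  have h2 := hT' b'
  unfold trace at h2
  simp only [wPoint, if_true, x₁Point, autPoint, map_sub, map_smul, h1]
  refine S.not_opposite_of_inc (l := l5 0 u b' u' (h b' - u • S.one)) (m := l4 u _ _ b')
    ⟨rfl, rfl, rfl, rfl⟩ (q := p5 u (h b' - u • S.one) _ b' u) ⟨by simp, ?_, ?_, ?_⟩
    ⟨rfl, rfl, rfl, rfl⟩ ⟨rfl, rfl, rfl⟩
  · simp only [S.norm_one, S.sharp_one, S.norm_zero, S.sharp_zero, map_zero, map_sub, map_smul,
      S.tr_comm S.one, h2, smul_eq_mul]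
    ring
  · simp [S.sharp_zero]
  · simp [S.norm_zero, S.sharp_zero]

include hh hT hT' in
/-- If the line `[b]` is fixed then `N(b) = -1`, so that all its points are fixed. -/
lemma norm_eq_neg_one (hord : ∀ a, h (h (h a)) = a) {b : J} (hb : b ≠ 0)
    (hfix : h (-S.inv b + S.one) = b) : S.norm b = -1 := by
  have hn := S.norm_ne_zero hb
  have h1 := isAut_one hh hT'
  obtain ⟨n, hnn⟩ : ∃ n, n = S.norm b := ⟨_, rfl⟩
  -- Fixing [b] means (b⁻¹)^h = 1 - b; multiply by n = N(b).
  have e1 : S.sharp (h b) = n • (S.one - b) := by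
    rw [← hh, S.sharp_eq hb, map_smul, ← hnn]
    conv_rhs => rw [← hfix, map_add, h1, map_neg]
    congr 1; abel
  -- Applying h twice and using h³ = 1 turns (b^h)^# into b^#.
  have e2 : S.sharp b = n • (S.one - h (h b)) := by
    have := congrArg (fun x => h (h x)) e1
    rwa [hh, hh, hord, map_smul, map_smul, map_sub, map_sub, h1, h1] at this
  rw [← hnn] at hn ⊢
  have e3 : S.trace (S.sharp b) = n * (3 - S.trace b) := by
    rw [e2, trace, map_smul, map_sub, LinearMap.smul_apply, LinearMap.sub_apply, ← trace, ← trace,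
      trace_one, isAut_trace hh hT', isAut_trace hh hT', smul_eq_mul]
  have e4 : h b = n • (S.one - S.trace b • S.one + b + S.sharp b) := by
    have h2 := S.sharp_sharp (h b)
    rw [e1, S.sharp_smul, S.sharp_sub, S.cross_one, S.sharp_one, S.isAut_norm hh, ← hnn] at h2
    apply smul_right_injective J hn
    simp only
    rw [← h2, trace]
    module
  by_contra hne
  have hne' : 1 + n ≠ 0 := fun h0 => hne (by linear_combination h0)
  -- Eliminating b^# and b^(h²) from `e4` gives this relation multiplied by 1 + n, which is nonzero
  -- under the assumption n ≠ -1.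
  have e5 : (1 - n) • h b = n • (S.one - S.trace b • S.one + b) := by
    apply smul_right_injective J hne'
    simp only
    have h2 := hT b
    have h3 : h (h b) = S.trace b • S.one - b - h b := by rw [h2]; abel
    rw [e2, h3] at e4
    rw [← sub_eq_zero] at e4 ⊢
    rw [← e4]
    module
  have e6 : (1 - n) * S.trace b = n * (3 - 3 * S.trace b + S.trace b) := by
    have h2 := congrArg S.trace e5
    simp only [trace, map_smul, map_sub, map_add, LinearMap.smul_apply, LinearMap.sub_apply,
      LinearMap.add_apply, smul_eq_mul] at h2
    rw [← trace, ← trace, ← trace, isAut_trace hh hT', trace_one] at h2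
    linear_combination h2
  -- Taking norms in `e1` supplies a second scalar equation. With `e6` it determines T(b) = n + 1
  -- and n² - n + 1 = 0.
  have e7 : n * (1 - S.trace b + S.trace (S.sharp b) - n) = 1 := by
    have h2 := norm_add_smul_one (S := S) b (-1)
    have h3 := congrArg S.norm e1
    rw [S.norm_sharp, S.isAut_norm hh, S.norm_smul, ← neg_sub, S.norm_neg, sub_eq_add_neg,
      ← neg_one_smul F S.one, h2, ← hnn] at h3
    apply mul_left_cancel₀ (pow_ne_zero 2 hn)
    linear_combination -h3
  have e8 : n * S.trace b = 2 * n - 1 := by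
    apply mul_left_cancel₀ hne'
    rw [e3] at e7
    linear_combination -e7
  have e9 : S.trace b = n + 1 := by linear_combination e6 - e8
  have e10 : n ^ 2 - n + 1 = 0 := by rw [e9] at e8; linear_combination e8
  -- The scalar relations give N(b - n1) = n(n² - n + 1) = 0. Hence n = N(n1) = n³, while n³ = -1,
  -- contradicting n ≠ -1.
  have e11 : b = n • S.one := by
    rw [← sub_eq_zero, sub_eq_add_neg, ← neg_smul, ← S.norm_eq_zero_iff, norm_add_smul_one, e3, e9,
      ← hnn]
    linear_combination n * e10
  have e12 : n = n ^ 3 := by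
    have := hnn
    rwa [e11, S.norm_smul, S.norm_one, mul_one] at this
  exact hne (by linear_combination e12 + (n + 1) * e10)

include hh hT hT' in
lemma not_opposite_map_p4 (hord : ∀ a, h (h (h a)) = a) {b : J} (hb : b ≠ 0) (u : F) (b' : J)
    (u' : F) : ¬ S.Opposite (Sum.inl (p4 b u b' u'))
      (Sum.inl (autPoint h (S.x₁Point S.one (S.wPoint (p4 b u b' u'))))) := by
  by_cases hfix : h (-S.inv b + S.one) = b
  · have hn := norm_eq_neg_one hh hT hT' hord hb hfix
    simp only [wPoint, hb, if_false, x₁Point, autPoint, hfix, hn]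
    refine S.not_opposite_of_inc (l := l3 b u b') (m := l3 b u _) (q := p2 b u) ⟨rfl, rfl, rfl⟩
      ⟨rfl, rfl⟩ ⟨rfl, rfl⟩ ⟨rfl, ?_, rfl⟩
    ring
  have hθ := (S.ofAut h hh * S.x₁ S.one * S.w).2
  obtain ⟨U, hU⟩ : ∃ U, U = -((S.norm b)⁻¹ * u) := ⟨_, rfl⟩
  obtain ⟨B', hB'⟩ : ∃ B', B' = h (S.cross (S.inv b) b' -
    ((S.norm b)⁻¹ * (u + S.tr b b')) • b) := ⟨_, rfl⟩
  obtain ⟨U', hU'⟩ : ∃ U', U' = u' - (S.norm b)⁻¹ * u * (u + S.tr b b')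
    - S.tr (S.inv b) (S.sharp b') := ⟨_, rfl⟩
  -- The image of the given point is (B, U, B', U') with B = h(-b⁻¹ + 1). The generic point obtained
  -- here is collinear with the given point and with some (B, U, B', X); it remains to identify X
  -- with U'.
  obtain ⟨t, a, t', a', t'', b'', X, B'', h1, h2⟩ := S.exists_inc_inc hfix u b' u' U B'
  have h3 := (hθ _ _).2 h1
  change S.Inc (autPoint h (S.x₁Point S.one (S.wPoint (p5 t a t' a' t''))))
    (autLine h (S.x₁Line S.one (S.wLine (l5 b u b' u' b'')))) at h3
  obtain ⟨e, he⟩ := map_p5 hh hT hT' t a t' a' t''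
  simp only [wPoint, wLine, hb, if_false, x₁Point, x₁Line, autPoint, autLine, ← hU, ← hB',
    ← hU'] at h3 he ⊢
  -- The generic point lies on a line [B, U, B', X, ·] and its image on a line [B, U, B', U', ·], so
  -- the quartic form of their difference is (U' - X)². By `map_p5` and `quartic_eq_zero` it is also
  -- 0.
  obtain rfl : U' = X := by
    rw [UPlus.inc_iff_cosets_meet] at h2 h3
    obtain ⟨c, s, h2⟩ := h2
    obtain ⟨c', s', h3⟩ := h3
    rw [UPlus.normal_form] at h2 h3
    have h4 := (congrArg UPlus.toPoint h3).symm.trans he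
    have h5 : (⟨t, a, t', a', t'', 0⟩ * UPlus.y₁ S c : UPlus S) = ⟨t, a, t', a', t'', c⟩ := by
      ext <;> simp [UPlus.mul_def, UPlus.y₁, S.sharp_zero, S.norm_zero]
    obtain ⟨g, hg⟩ : ∃ g : UPlus S, g = ⟨t, a, t', a', t'', 0⟩ := ⟨_, rfl⟩
    rw [← hg] at h4 h5
    have h6 := UPlus.quartic_congr (UPlus.toPoint_mul g⁻¹ h4)
    -- U₄, U₅ and U₆ commute with each other, so the two reversed normal forms, which share their
    -- first three factors, differ by the componentwise difference of the last three.
    have h7 : ∀ (z : UPlus S) (d d' : J), z * UPlus.y₄ S U' * UPlus.y₅ S d' * UPlus.y₆ S s' =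
        z * UPlus.y₄ S X * UPlus.y₅ S d * UPlus.y₆ S s *
          ⟨s' - s, d' - d, U' - X, 0, 0, 0⟩ := by
      intro z d d'
      simp only [mul_assoc]
      congr 1
      ext <;> simp [UPlus.mul_def, UPlus.y₄, UPlus.y₅, UPlus.y₆, S.sharp_zero, S.norm_zero]
    rw [inv_mul_cancel_left, quartic_eq_zero hh hT', h7 _ B'', ← h2, ← h5, mul_assoc,
      inv_mul_cancel_left, UPlus.quartic_y₁_mul] at h6
    exact sub_eq_zero.1 (pow_eq_zero_iff two_ne_zero |>.1 h6)
  exact S.not_opposite_of_inc (l := l5 b u b' u' b'') (q := p5 t a t' a' t'')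
    ⟨rfl, rfl, rfl, rfl⟩ h1 h2 ⟨rfl, rfl, rfl, rfl⟩

end Domestic

end

end HexagonalSystem

theorem mainTheorem5 {F J : Type*} [Field F] [AddCommGroup J] [Module F J]
    (S : HexagonalSystem F J) (h : J ≃ₗ[F] J) (hh : S.IsAut h)
    (hord : orderOf h = 1 ∨ orderOf h = 3)
    (hT : ∀ a : J, S.trace a • S.one = a + h a + h (h a))
    (hT' : ∀ a : J, S.trace (S.sharp a) = S.tr a (h a)) :
    S.PointDomestic (S.ofAut h hh * S.x₁ S.one * S.s₁ S.one) := by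
  have hord3 : ∀ a, h (h (h a)) = a := by
    have h3 : h ^ 3 = 1 := orderOf_dvd_iff_pow_eq_one.1 (by rcases hord with h | h <;> simp [h])
    exact fun a => LinearEquiv.congr_fun h3 a
  rw [S.s₁_one]
  intro p
  change ¬ S.Opposite (Sum.inl p)
    (Sum.inl (HexagonalSystem.autPoint h (S.x₁Point S.one (S.wPoint p))))
  cases p with
  | p0 => simp [HexagonalSystem.wPoint, HexagonalSystem.x₁Point, HexagonalSystem.autPoint,
      HexagonalSystem.Opposite]
  -- θ fixes (∞), so a point collinear with (∞) and its image have (∞) as a common neighbour. This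
  -- settles the points (t) and (b, u).
  | p1 t =>
    exact S.not_opposite_of_inc (l := .l0) (q := .p0) (m := .l1 (h (0 + S.one)))
      trivial trivial trivial rfl
  | p2 b u =>
    by_cases hb : b = 0
    · simp only [HexagonalSystem.wPoint, hb, if_true, HexagonalSystem.x₁Point,
        HexagonalSystem.autPoint]
      exact S.not_opposite_of_inc (l := .l1 0) (q := .p0) (m := .l0) rfl trivial trivial trivial
    · simp only [HexagonalSystem.wPoint, hb, if_false, HexagonalSystem.x₁Point,
        HexagonalSystem.autPoint]
      exact S.not_opposite_of_inc (l := .l1 b) (q := .p0) (m := .l1 _) rfl trivial trivial rfl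
  | p3 t a t' => exact HexagonalSystem.not_opposite_map_p3 hh hT' t a t'
  | p4 b u b' u' =>
    by_cases hb : b = 0
    · subst hb
      exact HexagonalSystem.not_opposite_map_p4_zero hh hT' u b' u'
    · exact HexagonalSystem.not_opposite_map_p4 hh hT hT' hord3 hb u b' u'
  | p5 t a t' a' t'' => exact HexagonalSystem.not_opposite_map_p5 hh hT hT' t a t' a' t''
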